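/- **Setting.** Let $n\in\{1,2,3\}$, let $\Omega\subset\mathbb R^n$ be open, bounded and connected, and let $Y=(0,1)^n$ contain two disjoint open sets $Y_l,Y_s$ with $\overline{Y_l}\cup\overline{Y_s}=\overline Y$ and $\overline{Y_s}\subset Y$. For $0<\varepsilon<1$ let $K_\varepsilon=\{k\in\mathbb Z^n:\varepsilon(k+Y)\subset\Omega\}$ and assume $\overline\Omega=\bigcup_{k\in K_\varepsilon}\varepsilon(k+\overline Y)$. The pore space is $\Omega_\varepsilon=\Omega\cap\operatorname{int}\bigcup_{k\in K_\varepsilon}\varepsilon(k+\overline{Y_l})$, and its inner boundary is $\Gamma_\varepsilon=\bigcup_{k\in K_\varepsilon}\varepsilon(k+\overline{Y_l}\cap\overline{Y_s})$. Assume that $\Omega_\varepsilon$ is connected and has $C^{0,1}$ boundary. Let $\Gamma_{\varepsilon,D}\subset\Gamma_\varepsilon$ be measurable and $\Gamma_{\varepsilon,N}=\Gamma_\varepsilon\setminus\Gamma_{\varepsilon,D}$. Let $\alpha,\beta,\gamma,\sigma,\Phi_D\in\mathbb R$ and $T>0$ be constants, and let $c^{\pm,0}:\Omega\to\mathbb R$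 be measurable with $0\le c^{\pm,0}(x)\le\Lambda$ for all $x\in\Omega$, where $\Lambda$ does not depend on $\varepsilon$. A weak solution of Problem $\tilde P_\varepsilon$ is a tuple $(v,p,\Phi,c^+,c^-)$ with $v\in L^\infty(0,T;H^1_0(\Omega_\varepsilon)^n)$, $p\in L^\infty(0,T;L^2(\Omega_\varepsilon))$, $\Phi\in L^\infty(0,T;H^1(\Omega_\varepsilon))$, $c^\pm\in L^\infty(0,T;L^2(\Omega_\varepsilon))\cap L^2(0,T;H^1(\Omega_\varepsilon))$, $\partial_tc^\pm\in L^2(0,T;(H^1(\Omega_\varepsilon))')$, $c^\pm(0)=c^{\pm,0}$ on $\Omega_\varepsilon$, and $\Phi=\Phi_D$ on $\Gamma_{\varepsilon,D}$ in the sense of traces, such that for almost every $t\in(0,T)$ (the integrals on the right of the first equation and in the flux term of the last one being required to exist) $$\int_{\Omega_\varepsilon}\varepsilon^2\nabla v:\nabla\varphi_1-p\,\nabla\cdot\varphi_1\,dx=-\int_{\Omega_\varepsilon}\varepsilon^\beta(c^+-c^-)\nabla\Phi\cdot\varphi_1\,dx,\qquad \int_{\Omega_\varepsilon}v\cdot\nabla\psi\,dx=0,$$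 $$\int_{\Omega_\varepsilon}\varepsilon^\alpha\nabla\Phi\cdot\nabla\varphi_2\,dx-\int_{\Gamma_{\varepsilon,N}}\varepsilon\sigma\varphi_2\,do=\int_{\Omega_\varepsilon}(c^+-c^-)\varphi_2\,dx,$$ $$\langle\partial_tc^\pm,\varphi_3\rangle+\int_{\Omega_\varepsilon}\bigl(-vc^\pm+\nabla c^\pm\pm\varepsilon^\gamma\max(0,c^\pm)\nabla\Phi\bigr)\cdot\nabla\varphi_3\,dx=\mp\int_{\Omega_\varepsilon}(c^+-c^-)\varphi_3\,dx$$ for all $\varphi_1\in H^1_0(\Omega_\varepsilon)^n$, all $\psi,\varphi_3\in H^1(\Omega_\varepsilon)$, and all $\varphi_2\in H^1(\Omega_\varepsilon)$ with zero trace on $\Gamma_{\varepsilon,D}$. **Theorem.** For every such $\varepsilon$ and every weak solution $(v,p,\Phi,c^+,c^-)$ of Problem $\tilde P_\varepsilon$ the concentrations are bounded from above uniformly in $\varepsilon$, in each of the following two cases. 1. If the volume additivity constraint $c^++c^-=1$ holds almost everywhere in $(0,T)\times\Omega_\varepsilon$ (with any of the above boundary conditions for $\Phi$), then $c^\pm\le\Lambda$,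 and also $c^\pm\le1$, almost everywhere in $(0,T)\times\Omega_\varepsilon$. 2. If the potential satisfies homogeneous Neumann conditions, i.e. $\Gamma_{\varepsilon,D}=\emptyset$ and $\sigma=0$, then $c^\pm\le\Lambda$ almost everywhere in $(0,T)\times\Omega_\varepsilon$, without the volume additivity constraint. -/

import Mathlib

open MeasureTheory Set Filter Topology
open scoped ContDiff RealInnerProductSpace

noncomputable section

namespace SNPP

/-! ## Geometry: the periodically perforated domain -/

/-- The physical space `ℝⁿ` with its Euclidean norm. -/
abbrev E (n : ℕ) := EuclideanSpace ℝ (Fin n)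

/-- The open unit cell `Y = (0,1)ⁿ`. -/
def unitCell (n : ℕ) : Set (E n) := {y | ∀ i, 0 < y i ∧ y i < 1}

/-- The unit cell consists of a liquid part `Yl` and a solid part `Ys`: disjoint open sets whose
closures fill the closed cell, the solid part not touching the boundary of the cell. -/
structure IsCellDecomposition {n : ℕ} (Yl Ys : Set (E n)) : Prop where
  isOpen_liquid : IsOpen Yl
  isOpen_solid : IsOpen Ys
  disjoint : Disjoint Yl Ys
  closure_union : closure Yl ∪ closure Ys = closure (unitCell n)
  solid_inside : closure Ys ⊆ unitCell n

/-- The scaled and shifted copy `ε (k + S)` of a subset `S` of the (closed) unit cell. -/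
def cellCopy {n : ℕ} (ε : ℝ) (k : Fin n → ℤ) (S : Set (E n)) : Set (E n) :=
  (fun y : E n => ε • (WithLp.toLp 2 (fun i => (k i : ℝ)) + y)) '' S

/-- The indices of those cells of the `ε`-mesh that lie in `Ω`. -/
def cellIndices {n : ℕ} (Ω : Set (E n)) (ε : ℝ) : Set (Fin n → ℤ) :=
  {k | cellCopy ε k (unitCell n) ⊆ Ω}

/-- `Ω` is completely covered by `ε`-scaled cells. -/
def IsCoveredByCells {n : ℕ} (Ω : Set (E n)) (ε : ℝ) : Prop :=
  closure Ω = ⋃ k ∈ cellIndices Ω ε, cellCopy ε k (closure (unitCell n))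

/-- The pore space `Ω_ε`: the union of the liquid parts of all cells (together with the
interfaces between neighbouring cells, which the union of the open parts would miss). -/
def poreSpace {n : ℕ} (Ω Yl : Set (E n)) (ε : ℝ) : Set (E n) :=
  Ω ∩ interior (⋃ k ∈ cellIndices Ω ε, cellCopy ε k (closure Yl))

/-- The inner boundary `Γ_ε`: the union of the scaled copies of `Γ`, the intersection of the
closures of the liquid and the solid part. -/
def innerBoundary {n : ℕ} (Ω Yl Ys : Set (E n)) (ε : ℝ) : Set (E n) :=
  ⋃ k ∈ cellIndices Ω ε, cellCopy ε k (closure Yl ∩ closure Ys)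

/-- `C^{0,1}` boundary: near each boundary point the set is, in some direction `d`, the part
of space strictly above the graph of a Lipschitz function on the hyperplane `d^⊥`. -/
def HasLipschitzBoundary {n : ℕ} (U : Set (E n)) : Prop :=
  ∀ x ∈ frontier U, ∃ (d : E n) (ψ : E n → ℝ) (L : NNReal) (r : ℝ),
    ‖d‖ = 1 ∧ LipschitzWith L ψ ∧ 0 < r ∧
      ∀ y ∈ Metric.ball x r, (y ∈ U ↔ ψ (y - ⟪d, y⟫ • d) < ⟪d, y⟫)

/-- The `(n-1)`-dimensional surface measure. -/
def surfaceMeasure (n : ℕ) : Measure (E n) := Measure.euclideanHausdorffMeasure (n - 1)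

/-! ## Sobolev spaces -/

/-- `φ ∈ C_c^∞(U)`. -/
structure IsTestFunction {n : ℕ} (U : Set (E n)) (φ : E n → ℝ) : Prop where
  smooth : ContDiff ℝ ∞ φ
  compact : HasCompactSupport φ
  support : tsupport φ ⊆ U

/-- `L²(U)`. -/
abbrev L2 {n : ℕ} (U : Set (E n)) := Lp ℝ 2 (volume.restrict U)

/-- `L²(U; ℝⁿ)`. -/
abbrev L2Vec {n : ℕ} (U : Set (E n)) := Lp (E n) 2 (volume.restrict U)

/-- `G` is the weak gradient of `u` in `U`. -/
def IsWeakGradient {n : ℕ} (U : Set (E n)) (u : E n → ℝ) (G : E n → E n) : Prop :=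
  ∀ φ : E n → ℝ, IsTestFunction U φ →
    ∫ x in U, u x • gradient φ x = - ∫ x in U, φ x • G x

theorem IsTestFunction.continuous_gradient {n : ℕ} {U : Set (E n)} {φ : E n → ℝ}
    (h : IsTestFunction U φ) : Continuous (gradient φ) := by
  unfold gradient
  exact (InnerProductSpace.toDual ℝ (E n)).symm.continuous.comp
    (h.smooth.continuous_fderiv (by simp))

theorem IsTestFunction.compact_gradient {n : ℕ} {U : Set (E n)} {φ : E n → ℝ}
    (h : IsTestFunction U φ) : HasCompactSupport (gradient φ) := by
  refine (h.compact.fderiv (𝕜 := ℝ)).mono ?_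
  intro x hx hx'
  apply hx
  simp [gradient, hx']

theorem IsTestFunction.integrable_smul_gradient {n : ℕ} {U : Set (E n)} {φ : E n → ℝ}
    (h : IsTestFunction U φ) (u : L2 U) :
    Integrable (fun x => u x • gradient φ x) (volume.restrict U) := by
  have h1 : MemLp (gradient φ) 2 (volume.restrict U) :=
    h.continuous_gradient.memLp_of_hasCompactSupport h.compact_gradient
  exact memLp_one_iff_integrable.1 (h1.smul (Lp.memLp u))

theorem IsTestFunction.integrable_smul_vec {n : ℕ} {U : Set (E n)} {φ : E n → ℝ}
    (h : IsTestFunction U φ) (G : L2Vec U) :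
    Integrable (fun x => φ x • G x) (volume.restrict U) := by
  have h1 : MemLp φ 2 (volume.restrict U) :=
    h.smooth.continuous.memLp_of_hasCompactSupport h.compact
  exact memLp_one_iff_integrable.1 ((Lp.memLp G).smul h1)

/-- The Sobolev space `H¹(U)` as the subspace of pairs of a function in `L²(U)` and its weak
gradient in `L²(U; ℝⁿ)`, with the norm `(‖u‖² + ‖∇u‖²)^{1/2}`. -/
def h1Subspace {n : ℕ} (U : Set (E n)) : Submodule ℝ (WithLp 2 (L2 U × L2Vec U)) where
  carrier := {z | IsWeakGradient U z.fst z.snd}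
  zero_mem' := by
    intro φ hφ
    have h1 : ∫ x in U, ((0 : L2 U) : E n → ℝ) x • gradient φ x = 0 := by
      refine integral_eq_zero_of_ae ?_
      filter_upwards [Lp.coeFn_zero ℝ 2 (volume.restrict U)] with x hx
      rw [hx, Pi.zero_apply, zero_smul, Pi.zero_apply]
    have h2 : ∫ x in U, φ x • ((0 : L2Vec U) : E n → E n) x = 0 := by
      refine integral_eq_zero_of_ae ?_
      filter_upwards [Lp.coeFn_zero (E n) 2 (volume.restrict U)] with x hx
      rw [hx]
      exact smul_zero _
    change ∫ x in U, ((0 : L2 U) : E n → ℝ) x • gradient φ x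
      = - ∫ x in U, φ x • ((0 : L2Vec U) : E n → E n) x
    rw [h1, h2, neg_zero]
  add_mem' := by
    intro a b ha hb φ hφ
    have e1 : ∫ x in U, ((a.fst + b.fst : L2 U) : E n → ℝ) x • gradient φ x
        = (∫ x in U, a.fst x • gradient φ x) + ∫ x in U, b.fst x • gradient φ x := by
      rw [← integral_add (hφ.integrable_smul_gradient _) (hφ.integrable_smul_gradient _)]
      refine integral_congr_ae ?_
      filter_upwards [Lp.coeFn_add a.fst b.fst] with x hx
      rw [hx, Pi.add_apply, add_smul]
    have e2 : ∫ x in U, φ x • ((a.snd + b.snd : L2Vec U) : E n → E n) x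
        = (∫ x in U, φ x • a.snd x) + ∫ x in U, φ x • b.snd x := by
      rw [← integral_add (hφ.integrable_smul_vec _) (hφ.integrable_smul_vec _)]
      refine integral_congr_ae ?_
      filter_upwards [Lp.coeFn_add a.snd b.snd] with x hx
      rw [hx, Pi.add_apply, smul_add]
    change ∫ x in U, ((a.fst + b.fst : L2 U) : E n → ℝ) x • gradient φ x
      = - ∫ x in U, φ x • ((a.snd + b.snd : L2Vec U) : E n → E n) x
    rw [e1, e2, ha φ hφ, hb φ hφ, neg_add]
  smul_mem' := by
    intro r a ha φ hφ
    have e1 : ∫ x in U, ((r • a.fst : L2 U) : E n → ℝ) x • gradient φ x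
        = r • ∫ x in U, a.fst x • gradient φ x := by
      rw [← integral_smul]
      refine integral_congr_ae ?_
      filter_upwards [Lp.coeFn_smul r a.fst] with x hx
      rw [hx, Pi.smul_apply, smul_assoc]
    have e2 : ∫ x in U, φ x • ((r • a.snd : L2Vec U) : E n → E n) x
        = r • ∫ x in U, φ x • a.snd x := by
      rw [← integral_smul]
      refine integral_congr_ae ?_
      filter_upwards [Lp.coeFn_smul r a.snd] with x hx
      simp only [hx, Pi.smul_apply]
      exact smul_comm _ _ _
    change ∫ x in U, ((r • a.fst : L2 U) : E n → ℝ) x • gradient φ x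
      = - ∫ x in U, φ x • ((r • a.snd : L2Vec U) : E n → E n) x
    rw [e1, e2, ha φ hφ, smul_neg]

/-- The Sobolev space `H¹(U)`. -/
abbrev H1 {n : ℕ} (U : Set (E n)) := ↥(h1Subspace U)

/-- The function underlying an element of `H¹(U)`. -/
def H1.fn {n : ℕ} {U : Set (E n)} (u : H1 U) : L2 U := (u : WithLp 2 (L2 U × L2Vec U)).fst

/-- The weak gradient of an element of `H¹(U)`. -/
def H1.grad {n : ℕ} {U : Set (E n)} (u : H1 U) : L2Vec U :=
  (u : WithLp 2 (L2 U × L2Vec U)).snd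

/-- The function `u ∈ H¹(U)` and the smooth function `φ` are `δ`-close in `H¹(U)`. -/
def H1.IsClose {n : ℕ} {U : Set (E n)} (u : H1 U) (φ : E n → ℝ) (δ : ℝ) : Prop :=
  eLpNorm (fun x => u.fn x - φ x) 2 (volume.restrict U) ≤ ENNReal.ofReal δ ∧
  eLpNorm (fun x => u.grad x - gradient φ x) 2 (volume.restrict U) ≤ ENNReal.ofReal δ

/-- `u ∈ H¹₀(U)`: `u` lies in the closure of `C_c^∞(U)` in `H¹(U)`. -/
def H1.MemH10 {n : ℕ} {U : Set (E n)} (u : H1 U) : Prop :=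
  ∀ δ : ℝ, 0 < δ → ∃ φ : E n → ℝ, IsTestFunction U φ ∧ u.IsClose φ δ

/-- `g ∈ L²(S)` is the trace of `u ∈ H¹(U)` on the boundary portion `S`: there are functions
smooth up to the boundary converging to `u` in `H¹(U)` and to `g` in `L²(S)`. -/
def H1.IsTrace {n : ℕ} {U : Set (E n)} (u : H1 U) (S : Set (E n)) (g : E n → ℝ) : Prop :=
  MemLp g 2 ((surfaceMeasure n).restrict S) ∧
  ∀ δ : ℝ, 0 < δ → ∃ φ : E n → ℝ, ContDiff ℝ ∞ φ ∧ HasCompactSupport φ ∧ u.IsClose φ δ ∧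
    eLpNorm (fun x => g x - φ x) 2 ((surfaceMeasure n).restrict S) ≤ ENNReal.ofReal δ

open Classical in
/-- The trace of `u ∈ H¹(U)` on the boundary portion `S`. For bounded sets `U` with Lipschitz
boundary and `S ⊆ ∂U` it exists and is unique almost everywhere on `S`. -/
def H1.trace {n : ℕ} {U : Set (E n)} (u : H1 U) (S : Set (E n)) : E n → ℝ :=
  if h : ∃ g, u.IsTrace S g then h.choose else 0

/-- Vector fields with components in `H¹(U)`. -/
abbrev H1Vec {n : ℕ} (U : Set (E n)) := PiLp 2 (fun _ : Fin n => H1 U)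

/-- The vector field underlying an element of `H¹(U)ⁿ`. -/
def H1Vec.fn {n : ℕ} {U : Set (E n)} (V : H1Vec U) (x : E n) : E n :=
  WithLp.toLp 2 (fun i => (V i).fn x)

/-- The divergence. -/
def H1Vec.div {n : ℕ} {U : Set (E n)} (V : H1Vec U) (x : E n) : ℝ := ∑ i, (V i).grad x i

/-- `V ∈ H¹₀(U)ⁿ`. -/
def H1Vec.MemH10 {n : ℕ} {U : Set (E n)} (V : H1Vec U) : Prop := ∀ i, (V i).MemH10

/-! ## Functions of time -/

/-- Lebesgue measure on `(0,T)`; thus `u ∈ L^q(0,T;X)` is `MemLp u q (timeMeasure T)`. -/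
def timeMeasure (T : ℝ) : Measure ℝ := volume.restrict (Ioo 0 T)

/-- `g = ∂ₜ c` in the sense of distributions on `(0,T)` with values in `(H¹(U))'`, where
`H¹(U)` is embedded in its dual through the inner product of `L²(U)`. -/
def IsWeakTimeDeriv {n : ℕ} {U : Set (E n)} (T : ℝ) (c : ℝ → H1 U)
    (g : ℝ → StrongDual ℝ (H1 U)) : Prop :=
  ∀ (φ : H1 U) (η : ℝ → ℝ), ContDiff ℝ ∞ η → HasCompactSupport η → tsupport η ⊆ Ioo 0 T →
    ∫ t, deriv η t * ⟪(c t).fn, φ.fn⟫ ∂(timeMeasure T)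
      = - ∫ t, η t * g t φ ∂(timeMeasure T)

/-- `c = c₀` at `t = 0`: the representative of `c` in `C([0,T];L²(U))` takes the value `c₀`. -/
def HasInitialValue {n : ℕ} {U : Set (E n)} (T : ℝ) (c : ℝ → H1 U) (c₀ : E n → ℝ) : Prop :=
  ∃ C : ℝ → L2 U, ContinuousOn C (Icc 0 T) ∧ (∀ᵐ t ∂(timeMeasure T), C t = (c t).fn) ∧
    ∀ᵐ x ∂(volume.restrict U), C 0 x = c₀ x

/-! ## Weak solutions of the modified Stokes-Nernst-Planck-Poisson problem -/

/-- Weak formulation of the Stokes equations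
`-ε² Δv + ∇p = -ε^β (c⁺ - c⁻) ∇Φ`, `∇·v = 0` with no-slip boundary condition. -/
structure SolvesStokes {n : ℕ} (U : Set (E n)) (ε β T : ℝ)
    (v : ℝ → H1Vec U) (p : ℝ → L2 U) (Φ cp cm : ℝ → H1 U) : Prop where
  velocity_mem : MemLp v ⊤ (timeMeasure T)
  no_slip : ∀ᵐ t ∂(timeMeasure T), (v t).MemH10
  pressure_mem : MemLp p ⊤ (timeMeasure T)
  momentum : ∀ᵐ t ∂(timeMeasure T), ∀ φ : H1Vec U, φ.MemH10 →
    Integrable (fun x => -(ε ^ β * ((cp t).fn x - (cm t).fn x) * ⟪(Φ t).grad x, φ.fn x⟫))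
      (volume.restrict U) ∧
    ∫ x in U, (ε ^ 2 * (∑ i, ⟪((v t) i).grad x, (φ i).grad x⟫) - p t x * φ.div x)
      = ∫ x in U, -(ε ^ β * ((cp t).fn x - (cm t).fn x) * ⟪(Φ t).grad x, φ.fn x⟫)
  incompressible : ∀ᵐ t ∂(timeMeasure T), ∀ ψ : H1 U,
    ∫ x in U, ⟪(v t).fn x, ψ.grad x⟫ = 0

/-- Weak formulation of the Poisson equation `-ε^α ΔΦ = c⁺ - c⁻` with `Φ = Φ_D` on the part `ΓD`
of the inner boundary `Γ`, `ε^α ∇Φ·ν = ε σ` on the remaining part of `Γ`, and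
`ε^α ∇Φ·ν = 0` on the outer boundary. -/
structure SolvesPoisson {n : ℕ} (U Γ ΓD : Set (E n)) (ε α σ ΦD T : ℝ)
    (Φ cp cm : ℝ → H1 U) : Prop where
  potential_mem : MemLp Φ ⊤ (timeMeasure T)
  dirichlet : ∀ᵐ t ∂(timeMeasure T),
    ∀ᵐ x ∂((surfaceMeasure n).restrict ΓD), (Φ t).trace Γ x = ΦD
  equation : ∀ᵐ t ∂(timeMeasure T), ∀ φ : H1 U,
    (∀ᵐ x ∂((surfaceMeasure n).restrict ΓD), φ.trace Γ x = 0) →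
      (∫ x in U, ε ^ α * ⟪(Φ t).grad x, φ.grad x⟫)
        - (∫ x in Γ \ ΓD, ε * σ * φ.trace Γ x ∂(surfaceMeasure n))
        = ∫ x in U, ((cp t).fn x - (cm t).fn x) * φ.fn x

/-- The total flux paired with `∇φ`: `(-v c + ∇c + z ε^γ max(0,c) ∇Φ) · ∇φ`, with `z = ± 1` and
the concentration in the drift term cut off at zero. -/
def fluxTerm {n : ℕ} {U : Set (E n)} (z ε γ : ℝ) (v : H1Vec U) (Φ c φ : H1 U) (x : E n) : ℝ :=
  ⟪-(c.fn x • v.fn x) + c.grad x + (z * ε ^ γ * max 0 (c.fn x)) • Φ.grad x, φ.grad x⟫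

/-- Weak formulation of the modified Nernst-Planck equation
`∂ₜc + ∇·(v c - ∇c - z ε^γ max(0,c) ∇Φ) = -z (c⁺ - c⁻)` with no-flux boundary condition and
initial value `c₀`, where `c = c⁺` for `z = 1` and `c = c⁻` for `z = -1`. The equation
presupposes that the flux term is integrable. -/
structure SolvesNernstPlanck {n : ℕ} (U : Set (E n)) (z ε γ T : ℝ) (c₀ : E n → ℝ)
    (v : ℝ → H1Vec U) (Φ cp cm c : ℝ → H1 U) : Prop where
  mem_Linfty_L2 : MemLp (fun t => (c t).fn) ⊤ (timeMeasure T)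
  mem_L2_H1 : MemLp c 2 (timeMeasure T)
  initial : HasInitialValue T c c₀
  equation : ∃ g : ℝ → StrongDual ℝ (H1 U), MemLp g 2 (timeMeasure T) ∧ IsWeakTimeDeriv T c g ∧
    ∀ᵐ t ∂(timeMeasure T), ∀ φ : H1 U,
      Integrable (fluxTerm z ε γ (v t) (Φ t) (c t) φ) (volume.restrict U) ∧
      g t φ + (∫ x in U, fluxTerm z ε γ (v t) (Φ t) (c t) φ x)
        = ∫ x in U, -(z * ((cp t).fn x - (cm t).fn x)) * φ.fn x

/-- `(v, p, Φ, c⁺, c⁻)` is a weak solution of the modified problem in the pore space `U` with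
inner boundary `Γ`, Dirichlet part `ΓD`, boundary data `σ`, `ΦD` and initial data `c₀⁺`, `c₀⁻`. -/
structure IsWeakSolution {n : ℕ} (U Γ ΓD : Set (E n)) (ε α β γ σ ΦD T : ℝ)
    (c₀p c₀m : E n → ℝ) (v : ℝ → H1Vec U) (p : ℝ → L2 U) (Φ cp cm : ℝ → H1 U) : Prop where
  stokes : SolvesStokes U ε β T v p Φ cp cm
  poisson : SolvesPoisson U Γ ΓD ε α σ ΦD T Φ cp cm
  nernst_planck_pos : SolvesNernstPlanck U 1 ε γ T c₀p v Φ cp cm cp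
  nernst_planck_neg : SolvesNernstPlanck U (-1) ε γ T c₀m v Φ cp cm cm

/-- Volume additivity constraint: `c⁺ + c⁻ = 1` almost everywhere in `(0,T) × U`. -/
def VolumeAdditivity {n : ℕ} {U : Set (E n)} (T : ℝ) (cp cm : ℝ → H1 U) : Prop :=
  ∀ᵐ t ∂(timeMeasure T), ∀ᵐ x ∂(volume.restrict U), (cp t).fn x + (cm t).fn x = 1

/-- `c ≤ M` almost everywhere in `(0,T) × U`. -/
def BoundedAboveBy {n : ℕ} {U : Set (E n)} (T : ℝ) (c : ℝ → H1 U) (M : ℝ) : Prop :=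
  ∀ᵐ t ∂(timeMeasure T), ∀ᵐ x ∂(volume.restrict U), (c t).fn x ≤ M

end SNPP

end

/-! The proof tests each Nernst-Planck equation with `φ = min (c - L)₊ 1`, `L ≥ 0`. Truncating from
above as well as from below keeps `c` between `L` and `L + 1` wherever `∇φ ≠ 0`, so that `c ∇φ` is
itself the gradient of an `H¹` function `χ` (`IsMoment`), with no a priori bound on `c`. Convection
then contributes `∫ v · ∇χ = 0` by incompressibility, diffusion has a good sign, and the drift
becomes `± ε^γ ∫ ∇Φ · ∇χ` (`apply_le_of_isRamp`). Only this drift and the reaction remain.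

Neumann case (`dissipation_of_neumann`): `χ⁺` and `χ⁻` are admissible in the Poisson equation. The
two drifts add up to a positive multiple of `∫ (c⁺ - c⁻)(χ⁺ - χ⁻)`, the reactions to `-∫ (c⁺ -
c⁻)(φ⁺ - φ⁻)`. Since `χ` and `φ` are increasing functions of the concentration, the same for both
species, both contributions are dissipative.

Volume additivity (`dissipation_of_volumeAdditivity`): in the sum of the two equations the time
derivatives, diffusion, convection and reactions cancel, which leaves `∫ (max 0 c⁺ - max 0 c⁻) ∇Φ ·
∇θ = 0` for every `θ`. With `c⁻ = 1 - c⁺` the prefactor is a function of `c⁺` that is positive above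
`1/2`. Dividing by it inside `θ` gives `∫ ∇Φ · ∇χ = 0`, whatever boundary conditions `Φ` satisfies.
The reaction is `-(2c - 1) φ ≤ 0` for the same reason. Levels `L > 1/2` suffice: the initial data
add up to `1`, so `Λ ≥ 1/2`, and being nonnegative they are at most `1`.

From dissipation to the bound (`boundedAbove_of_dissipative`): instead of a chain rule for `⟨∂ₜc,
φ(c)⟩`, convexity of the primitive of the truncation bounds an energy increment over `(t - τ, t)` by
`∫ g_r φ_t dr`, with `φ_t` frozen at the final time. Replacing `g_r` by `g_t` costs `o(τ)` after
integration in `t`, by continuity of translations in `L²`, and `g_t φ_t` is dissipative in total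
(`le_initial_of_increment_le`). The energy therefore stays at its initial value zero.

The parameter `ε` enters only through the positivity of `ε^α` and `ε^γ`, hence the uniform bounds.
The chain rule for weak gradients (`IsWeakGradient.primitive_comp`) supplies all test functions. -/

open MeasureTheory Set Filter Topology
open scoped ContDiff RealInnerProductSpace

noncomputable section

/-! ### Continuity of translations and convergence of mollifications -/

namespace SNPP

open scoped ENNReal Convolution

/-- Translation is continuous in `L^p`, `1 ≤ p < ∞`. -/
theorem tendsto_eLpNorm_translate_sub {V F : Type*} [NormedAddCommGroup V] [NormedSpace ℝ V]
    [FiniteDimensional ℝ V] [MeasurableSpace V] [BorelSpace V] [NormedAddCommGroup F]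
    {μ : Measure V} [μ.IsAddHaarMeasure] {p : ℝ≥0∞} [Fact (1 ≤ p)] (hp : p ≠ ⊤)
    {g : V → F} (hg : MemLp g p μ) :
    Tendsto (fun h => eLpNorm (fun x => g (x - h) - g x) p μ) (𝓝 0) (𝓝 0) := by
  let τ : C(V, C(V, V)) :=
    (ContinuousMap.mk (fun a : V × V => a.2 - a.1) (by fun_prop)).curry
  have hτ : ∀ h, MeasurePreserving (τ h) μ μ := fun h => measurePreserving_sub_right μ h
  have h1 : Tendsto (fun h => Lp.compMeasurePreserving (τ h) (hτ h) hg.toLp) (𝓝 0)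
      (𝓝 (Lp.compMeasurePreserving (τ 0) (hτ 0) hg.toLp)) :=
    Tendsto.compMeasurePreservingLp tendsto_const_nhds (τ.continuous.tendsto 0) hτ (hτ 0) hp
  have h2 := tendsto_iff_edist_tendsto_0.1 h1
  refine h2.congr fun h => ?_
  rw [Lp.edist_def]
  refine eLpNorm_congr_ae ?_
  have e0 := Lp.coeFn_compMeasurePreserving hg.toLp (hτ 0)
  have eh := Lp.coeFn_compMeasurePreserving hg.toLp (hτ h)
  have f0 := (hτ 0).quasiMeasurePreserving.ae_eq_comp hg.coeFn_toLp
  have fh := (hτ h).quasiMeasurePreserving.ae_eq_comp hg.coeFn_toLp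
  filter_upwards [e0, eh, f0, fh] with x h0 hh k0 kh
  rw [Pi.sub_apply, h0, hh, k0, kh]
  simp [τ]

section Mollification

variable {n : ℕ} {F : Type*} [NormedAddCommGroup F] [NormedSpace ℝ F] [CompleteSpace F]

/-- The mollification of `g` by a bump function. -/
def mollify (φ : ContDiffBump (0 : E n)) (g : E n → F) : E n → F :=
  (φ.normed volume ⋆[ContinuousLinearMap.lsmul ℝ ℝ, volume] g)

/-- The kernel has mass one, so `g x` can be moved under the integral. The right side is a weighted
average of translation errors, ready for Tonelli. -/
theorem mollify_sub_enorm_le (φ : ContDiffBump (0 : E n)) {g : E n → F} (hg : Integrable g)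
    (x : E n) : ‖mollify φ g x - g x‖ₑ ≤
      ∫⁻ y, ENNReal.ofReal (φ.normed volume y) * ‖g (x - y) - g x‖ₑ := by
  have h1 : Integrable (fun y => φ.normed volume y • g (x - y)) :=
    (φ.hasCompactSupport_normed.convolutionExists_left (ContinuousLinearMap.lsmul ℝ ℝ)
      φ.continuous_normed hg.locallyIntegrable x)
  have h2 : mollify φ g x - g x = ∫ y, φ.normed volume y • (g (x - y) - g x) := by
    simp_rw [smul_sub]
    rw [integral_sub h1 (φ.integrable_normed.smul_const _), φ.integral_normed_smul]
    rfl
  rw [h2]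
  refine (enorm_integral_le_lintegral_enorm _).trans (lintegral_mono fun y => ?_)
  rw [enorm_smul, Real.enorm_eq_ofReal (φ.nonneg_normed y)]

theorem lintegral_normed (φ : ContDiffBump (0 : E n)) :
    ∫⁻ y, ENNReal.ofReal (φ.normed volume y) = 1 := by
  rw [← ofReal_integral_eq_lintegral_ofReal φ.integrable_normed
    (Eventually.of_forall φ.nonneg_normed), φ.integral_normed, ENNReal.ofReal_one]

/-- Mollifications converge in `L¹`. -/
theorem tendsto_lintegral_mollify_sub {φ : ℕ → ContDiffBump (0 : E n)}
    (hφ : Tendsto (fun i => (φ i).rOut) atTop (𝓝 0)) {g : E n → F} (hg : Integrable g) :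
    Tendsto (fun i => ∫⁻ x, ‖mollify (φ i) g x - g x‖ₑ) atTop (𝓝 0) := by
  have hω := tendsto_eLpNorm_translate_sub (μ := volume) ENNReal.one_ne_top
    (memLp_one_iff_integrable.2 hg)
  rw [ENNReal.tendsto_nhds_zero] at hω ⊢
  intro η hη
  obtain ⟨δ, hδ, hball⟩ := Metric.eventually_nhds_iff.1 (hω η hη)
  filter_upwards [(tendsto_order.1 hφ).2 δ hδ] with i hi
  have hm : AEMeasurable (Function.uncurry fun x y =>
      ENNReal.ofReal ((φ i).normed volume y) * ‖g (x - y) - g x‖ₑ)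
      ((volume : Measure (E n)).prod volume) := by
    have h1 : AEMeasurable (fun p : E n × E n => ENNReal.ofReal ((φ i).normed volume p.2))
        ((volume : Measure (E n)).prod volume) :=
      ((φ i).continuous_normed.measurable.comp measurable_snd).ennreal_ofReal.aemeasurable
    refine h1.mul ?_
    refine AEStronglyMeasurable.enorm ?_
    refine AEStronglyMeasurable.sub ?_ hg.aestronglyMeasurable.comp_fst
    exact hg.aestronglyMeasurable.comp_quasiMeasurePreserving
      (quasiMeasurePreserving_sub volume volume)
  calc ∫⁻ x, ‖mollify (φ i) g x - g x‖ₑ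
      ≤ ∫⁻ x, ∫⁻ y, ENNReal.ofReal ((φ i).normed volume y) * ‖g (x - y) - g x‖ₑ :=
        lintegral_mono fun x => mollify_sub_enorm_le (φ i) hg x
    _ = ∫⁻ y, ∫⁻ x, ENNReal.ofReal ((φ i).normed volume y) * ‖g (x - y) - g x‖ₑ :=
        lintegral_lintegral_swap hm
    _ = ∫⁻ y, ENNReal.ofReal ((φ i).normed volume y) * eLpNorm (fun x => g (x - y) - g x) 1 := by
        refine lintegral_congr fun y => ?_
        rw [lintegral_const_mul' _ _ ENNReal.ofReal_ne_top, eLpNorm_one_eq_lintegral_enorm]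
    _ ≤ ∫⁻ y, ENNReal.ofReal ((φ i).normed volume y) * η := by
        refine lintegral_mono fun y => ?_
        -- Only translations shorter than the radius of the kernel carry weight, and for these the
        -- translation error is at most `η`.
        by_cases hy : y ∈ Metric.ball (0 : E n) (φ i).rOut
        · have : dist y 0 < δ := lt_trans hy hi
          gcongr
          exact hball this
        · rw [← (φ i).support_normed_eq (μ := volume), Function.notMem_support] at hy
          simp [hy]
    _ = η := by
        rw [lintegral_mul_const'' _ (φ i).continuous_normed.measurable.ennreal_ofReal.aemeasurable,
          lintegral_normed, one_mul]

end Mollification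

end SNPP

/-! ### Chain rule for weak gradients with a smooth outer function -/

namespace SNPP

section ChainRule

open scoped Convolution

variable {n : ℕ} {U : Set (E n)} {u : E n → ℝ} {G : E n → E n}

theorem inner_gradient (φ : E n → ℝ) (x v : E n) : ⟪gradient φ x, v⟫ = fderiv ℝ φ x v := by
  simp [gradient]

theorem IsTestFunction.continuous_fderiv_apply {φ : E n → ℝ} (h : IsTestFunction U φ) (v : E n) :
    Continuous fun x => fderiv ℝ φ x v :=
  (h.smooth.continuous_fderiv (by simp)).clm_apply continuous_const

theorem IsTestFunction.compact_fderiv_apply {φ : E n → ℝ} (h : IsTestFunction U φ) (v : E n) :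
    HasCompactSupport fun x => fderiv ℝ φ x v :=
  h.compact.fderiv_apply (𝕜 := ℝ) v

theorem _root_.HasCompactSupport.exists_abs_le {f : E n → ℝ} (hf : Continuous f)
    (hc : HasCompactSupport f) : ∃ K, ∀ x, ‖f x‖ ≤ K :=
  hf.bounded_above_of_compact_support hc

theorem integrable_smul_of_compactSupport {F : Type*} [NormedAddCommGroup F] [NormedSpace ℝ F]
    {μ : Measure (E n)} {f : E n → ℝ} {g : E n → F} (hf : Continuous f) (hc : HasCompactSupport f)
    (hg : Integrable g μ) : Integrable (fun x => f x • g x) μ := by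
  obtain ⟨K, hK⟩ := hc.exists_abs_le hf
  exact hg.bdd_smul K hf.aestronglyMeasurable (Eventually.of_forall hK)

/-- For integrable functions the weak gradient can be tested in each direction separately. -/
theorem isWeakGradient_iff (hu : IntegrableOn u U) (hG : IntegrableOn G U) :
    IsWeakGradient U u G ↔ ∀ φ, IsTestFunction U φ → ∀ v,
      ∫ x in U, fderiv ℝ φ x v * u x = - ∫ x in U, φ x * ⟪G x, v⟫ := by
  have key : ∀ φ, IsTestFunction U φ → ∀ v,
      ⟪v, ∫ x in U, u x • gradient φ x⟫ = ∫ x in U, fderiv ℝ φ x v * u x ∧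
      ⟪v, ∫ x in U, φ x • G x⟫ = ∫ x in U, φ x * ⟪G x, v⟫ := by
    intro φ hφ v
    constructor
    · rw [← integral_inner]
      · refine integral_congr_ae (Eventually.of_forall fun x => ?_)
        simp only
        rw [real_inner_comm, real_inner_smul_left, inner_gradient, mul_comm]
      · obtain ⟨K, hK⟩ := hφ.continuous_gradient.bounded_above_of_compact_support
          hφ.compact_gradient
        exact hu.smul_bdd K hφ.continuous_gradient.aestronglyMeasurable (Eventually.of_forall hK)
    · rw [← integral_inner]
      · refine integral_congr_ae (Eventually.of_forall fun x => ?_)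
        simp only
        rw [real_inner_comm, real_inner_smul_left]
      · exact integrable_smul_of_compactSupport hφ.smooth.continuous hφ.compact hG
  constructor
  · intro h φ hφ v
    rw [← (key φ hφ v).1, ← (key φ hφ v).2, h φ hφ, inner_neg_right]
  · intro h φ hφ
    refine ext_inner_left ℝ fun v => ?_
    rw [inner_neg_right, (key φ hφ v).1, (key φ hφ v).2, h φ hφ v]

/-- This makes the shifted kernel admissible in the definition of the weak gradient, as long as its
ball stays inside `U`. -/
theorem isTestFunction_normed_sub (φ : ContDiffBump (0 : E n)) {x : E n}
    (hx : Metric.closedBall x φ.rOut ⊆ U) :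
    IsTestFunction U fun y => φ.normed volume (x - y) := by
  have h0 : tsupport (fun y => φ.normed volume (x - y)) ⊆ Metric.closedBall x φ.rOut := by
    refine closure_minimal (fun y hy => ?_) Metric.isClosed_closedBall
    have : x - y ∈ Function.support (φ.normed volume) := hy
    rw [φ.support_normed_eq, mem_ball_zero_iff] at this
    rw [Metric.mem_closedBall, dist_comm, dist_eq_norm]
    exact this.le
  exact ⟨φ.contDiff_normed.comp (contDiff_const.sub contDiff_id),
    (isCompact_closedBall x φ.rOut).of_isClosed_subset (isClosed_tsupport _) h0, h0.trans hx⟩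

theorem contDiff_mollify (φ : ContDiffBump (0 : E n)) (hu : Integrable u) :
    ContDiff ℝ 1 (mollify φ u) :=
  φ.hasCompactSupport_normed.contDiff_convolution_left (n := 1) _ φ.contDiff_normed
    hu.locallyIntegrable

/-- Away from the boundary, the gradient of the mollification is the mollification of the weak
gradient. -/
theorem IsWeakGradient.fderiv_mollify (hU : MeasurableSet U) (h : IsWeakGradient U u G)
    (hu : IntegrableOn u U) (hG : IntegrableOn G U) (φ : ContDiffBump (0 : E n)) {x : E n}
    (hx : Metric.closedBall x φ.rOut ⊆ U) (v : E n) :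
    fderiv ℝ (mollify φ (U.indicator u)) x v = ⟪mollify φ (U.indicator G) x, v⟫ := by
  have hu' : Integrable (U.indicator u) := (integrable_indicator_iff hU).2 hu
  have hG' : Integrable (U.indicator G) := (integrable_indicator_iff hU).2 hG
  have e1 : mollify φ (U.indicator u) =
      (U.indicator u ⋆[(ContinuousLinearMap.lsmul ℝ ℝ : ℝ →L[ℝ] ℝ →L[ℝ] ℝ).flip, volume]
        φ.normed volume) := by
    rw [mollify, ← convolution_flip]
  have d1 := (φ.hasCompactSupport_normed (μ := volume)).hasFDerivAt_convolution_right
    (ContinuousLinearMap.lsmul ℝ ℝ : ℝ →L[ℝ] ℝ →L[ℝ] ℝ).flip hu'.locallyIntegrable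
    (φ.contDiff_normed (n := 1)) x
  have hT := isTestFunction_normed_sub φ hx
  have e2 := (isWeakGradient_iff hu hG).1 h _ hT v
  -- Differentiating the kernel in `y` instead of `x` changes the sign, which cancels the minus sign
  -- of the integration by parts.
  have e3 : ∀ y, fderiv ℝ (fun y => φ.normed volume (x - y)) y v
      = - fderiv ℝ (φ.normed volume) (x - y) v := by
    intro y
    have hd : HasFDerivAt (φ.normed volume) (fderiv ℝ (φ.normed volume) (x - y)) (x - y) :=
      ((φ.contDiff_normed (n := 1)).differentiable (by simp) _).hasFDerivAt
    have := hd.comp y ((hasFDerivAt_id y).const_sub x)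
    change HasFDerivAt (fun y => φ.normed volume (x - y)) _ y at this
    rw [this.fderiv]
    simp
  rw [e1, d1.fderiv, convolution_precompR_apply _ hu'.locallyIntegrable
    (φ.hasCompactSupport_normed.fderiv (𝕜 := ℝ))
    ((φ.contDiff_normed (n := 1)).continuous_fderiv (by simp))]
  have e4 : ⟪mollify φ (U.indicator G) x, v⟫ = ∫ y in U, φ.normed volume (x - y) * ⟪G y, v⟫ := by
    have hi : Integrable (fun y => φ.normed volume (x - y) • U.indicator G y) :=
      integrable_smul_of_compactSupport hT.smooth.continuous hT.compact hG'
    rw [mollify, convolution_eq_swap, real_inner_comm]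
    simp only [ContinuousLinearMap.lsmul_apply]
    rw [← integral_inner hi, ← integral_indicator hU]
    refine integral_congr_ae (Eventually.of_forall fun y => ?_)
    by_cases hy : y ∈ U
    · simp [hy, real_inner_smul_right, real_inner_comm]
    · simp [hy]
  rw [e4, ← neg_eq_iff_eq_neg.2 e2, convolution_def, ← integral_neg, ← integral_indicator hU]
  refine integral_congr_ae (Eventually.of_forall fun y => ?_)
  by_cases hy : y ∈ U
  · simp [hy, e3, mul_comm]
  · simp [hy]

/-- Chain rule for a continuously differentiable function with bounded derivative. -/
theorem IsWeakGradient.comp_of_continuous (hU : IsOpen U) (h : IsWeakGradient U u G)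
    (hu : IntegrableOn u U) (hG : IntegrableOn G U) {F f : ℝ → ℝ} {B : ℝ}
    (hF : ∀ s, HasDerivAt F (f s) s) (hf : Continuous f) (hB : ∀ s, |f s| ≤ B)
    (hFu : IntegrableOn (fun x => F (u x)) U)
    (hfG : IntegrableOn (fun x => f (u x) • G x) U) :
    IsWeakGradient U (fun x => F (u x)) (fun x => f (u x) • G x) := by
  have hu' : Integrable (U.indicator u) := (integrable_indicator_iff hU.measurableSet).2 hu
  have hG' : Integrable (U.indicator G) := (integrable_indicator_iff hU.measurableSet).2 hG
  have hB0 : 0 ≤ B := (abs_nonneg _).trans (hB 0)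
  have hFd : Differentiable ℝ F := fun s => (hF s).differentiableAt
  have hF1 : ContDiff ℝ 1 F := by
    rw [contDiff_one_iff_deriv]
    exact ⟨hFd, by rwa [show deriv F = f from funext fun s => (hF s).deriv]⟩
  have hLip : ∀ a b, |F a - F b| ≤ B * |a - b| := by
    intro a b
    have := Convex.norm_image_sub_le_of_norm_hasDerivWithin_le (f := F) (f' := f) (C := B)
      (s := univ) (x := b) (y := a) (fun s _ => (hF s).hasDerivWithinAt)
      (fun s _ => hB s) convex_univ (mem_univ _) (mem_univ _)
    simpa using this
  rw [isWeakGradient_iff hFu hfG]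
  intro φ hφ v
  -- Kernels of radius at most `δ` centred on the support of `φ` do not see the boundary of `U`. The
  -- outer radius is twice the inner one because almost everywhere convergence of mollifications
  -- needs a bounded ratio.
  obtain ⟨δ, hδ, hKδ⟩ := hφ.compact.isCompact.exists_cthickening_subset_open hU hφ.support
  let ρ : ℕ → ContDiffBump (0 : E n) := fun i =>
    ⟨δ / (2 * (i + 2)), δ / (i + 2), by positivity, by gcongr; linarith [show (0:ℝ) ≤ i by positivity]⟩
  have hρ0 : Tendsto (fun i => (ρ i).rOut) atTop (𝓝 0) := by
    have : Tendsto (fun i : ℕ => (i : ℝ) + 2) atTop atTop :=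
      tendsto_natCast_atTop_atTop.atTop_add tendsto_const_nhds
    exact Tendsto.div_atTop tendsto_const_nhds this
  have hρδ : ∀ i, (ρ i).rOut ≤ δ := fun i =>
    div_le_self hδ.le (by linarith [show (0:ℝ) ≤ i by positivity])
  have hρ2 : ∀ᶠ i in atTop, (ρ i).rOut ≤ 2 * (ρ i).rIn := Eventually.of_forall fun i => by
    change δ / (i + 2) ≤ 2 * (δ / (2 * (i + 2)))
    apply le_of_eq; field_simp
  have hball : ∀ i, ∀ x ∈ tsupport φ, Metric.closedBall x (ρ i).rOut ⊆ U := fun i x hx =>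
    (Metric.closedBall_subset_closedBall (hρδ i)).trans
      ((Metric.closedBall_subset_cthickening hx δ).trans hKδ)
  set w : ℕ → E n → ℝ := fun i => mollify (ρ i) (U.indicator u) with hw
  set W : ℕ → E n → E n := fun i => mollify (ρ i) (U.indicator G) with hW
  have hw1 : ∀ i, ContDiff ℝ 1 (w i) := fun i => contDiff_mollify _ hu'
  have hWc : ∀ i, Continuous (W i) := fun i =>
    ((ρ i).hasCompactSupport_normed.contDiff_convolution_left (n := 0) _
      (ρ i).contDiff_normed hG'.locallyIntegrable).continuous
  have hw_ae : ∀ᵐ x, Tendsto (fun i => w i x) atTop (𝓝 (U.indicator u x)) :=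
    ContDiffBump.ae_convolution_tendsto_right_of_locallyIntegrable hρ0 hρ2 hu'.locallyIntegrable
  have hw_L1 : Tendsto (fun i => ∫⁻ x, ‖w i x - U.indicator u x‖ₑ) atTop (𝓝 0) :=
    tendsto_lintegral_mollify_sub hρ0 hu'
  have hW_L1 : Tendsto (fun i => ∫⁻ x, ‖W i x - U.indicator G x‖ₑ) atTop (𝓝 0) :=
    tendsto_lintegral_mollify_sub hρ0 hG'
  obtain ⟨K, hK⟩ := hφ.compact.exists_abs_le hφ.smooth.continuous
  obtain ⟨K', hK'⟩ := (hφ.compact_fderiv_apply v).exists_abs_le (hφ.continuous_fderiv_apply v)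
  have hφ'0 : ∀ x, x ∉ U → fderiv ℝ φ x v = 0 := fun x hx => by
    have := (support_fderiv_subset ℝ (f := φ)).trans hφ.support
    rw [Function.notMem_support.1 fun h' => hx (this h')]; rfl
  -- the approximate identities
  have hid : ∀ i, ∫ x, fderiv ℝ φ x v * F (w i x) = - ∫ x, φ x * (f (w i x) * ⟪W i x, v⟫) := by
    intro i
    have hFw : ContDiff ℝ 1 (fun x => F (w i x)) := hF1.comp (hw1 i)
    have hd : ∀ x, fderiv ℝ (fun x => F (w i x)) x v = f (w i x) * fderiv ℝ (w i) x v := by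
      intro x
      have := (hF (w i x)).comp_hasFDerivAt x
        (((hw1 i).differentiable (by simp) x).hasFDerivAt)
      change HasFDerivAt (fun x => F (w i x)) _ x at this
      rw [this.fderiv]
      simp
    have hp := integral_mul_fderiv_eq_neg_fderiv_mul_of_integrable (μ := (volume : Measure (E n)))
      (f := φ) (g := fun x => F (w i x)) (v := v)
      ((((hφ.continuous_fderiv_apply v).mul hFw.continuous)).integrable_of_hasCompactSupport
        (hφ.compact_fderiv_apply v).mul_right)
      ((hφ.smooth.continuous.mul
        ((hFw.continuous_fderiv (by simp)).clm_apply continuous_const)).integrable_of_hasCompactSupport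
        hφ.compact.mul_right)
      ((hφ.smooth.continuous.mul hFw.continuous).integrable_of_hasCompactSupport
        hφ.compact.mul_right)
      (fun x _ => hφ.smooth.differentiable (by simp) x)
      (fun x _ => hFw.differentiable (by simp) x)
    rw [← neg_eq_iff_eq_neg.2 hp]
    congr 1
    refine integral_congr_ae (Eventually.of_forall fun x => ?_)
    by_cases hx : x ∈ tsupport φ
    · beta_reduce
      rw [hd, h.fderiv_mollify hU.measurableSet hu hG (ρ i) (hball i x hx) v]
    · simp [image_eq_zero_of_notMem_tsupport hx]
  -- the limits of both sides
  have hL : Tendsto (fun i => ∫ x, fderiv ℝ φ x v * F (w i x)) atTop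
      (𝓝 (∫ x in U, fderiv ℝ φ x v * F (u x))) := by
    have e : ∫ x in U, fderiv ℝ φ x v * F (u x)
        = ∫ x, fderiv ℝ φ x v * F (U.indicator u x) := by
      rw [← integral_indicator hU.measurableSet]
      refine integral_congr_ae (Eventually.of_forall fun x => ?_)
      by_cases hx : x ∈ U
      · simp [hx]
      · simp [hx, hφ'0 x hx]
    rw [e]
    refine tendsto_integral_of_L1 _ (Integrable.aestronglyMeasurable ?_) (Eventually.of_forall fun i => ?_) ?_
    · have : (fun x => fderiv ℝ φ x v * F (U.indicator u x))
          = U.indicator (fun x => fderiv ℝ φ x v * F (u x)) := by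
        funext x
        by_cases hx : x ∈ U
        · simp [hx]
        · simp [hx, hφ'0 x hx]
      rw [this, integrable_indicator_iff hU.measurableSet]
      exact integrable_smul_of_compactSupport (hφ.continuous_fderiv_apply v)
        (hφ.compact_fderiv_apply v) hFu
    · exact ((hφ.continuous_fderiv_apply v).mul
        (hF1.continuous.comp (hw1 i).continuous)).integrable_of_hasCompactSupport
        (hφ.compact_fderiv_apply v).mul_right
    · have h0 : Tendsto (fun i => ENNReal.ofReal (K' * B) * ∫⁻ x, ‖w i x - U.indicator u x‖ₑ)
          atTop (𝓝 0) := by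
        simpa using ENNReal.Tendsto.const_mul hw_L1 (Or.inr ENNReal.ofReal_ne_top)
      refine tendsto_of_tendsto_of_tendsto_of_le_of_le tendsto_const_nhds h0
        (fun _ => zero_le) fun i => ?_
      simp only
      rw [← lintegral_const_mul' _ _ ENNReal.ofReal_ne_top]
      refine lintegral_mono fun x => ?_
      have hK'0 : 0 ≤ K' := (norm_nonneg _).trans (hK' 0)
      rw [← ofReal_norm, ← ofReal_norm, ← ENNReal.ofReal_mul (by positivity), ← mul_sub, norm_mul,
        mul_assoc]
      refine ENNReal.ofReal_le_ofReal (mul_le_mul (hK' x) (hLip _ _) (norm_nonneg _) hK'0)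
  have hR : Tendsto (fun i => ∫ x, φ x * (f (w i x) * ⟪W i x, v⟫)) atTop
      (𝓝 (∫ x in U, φ x * ⟪f (u x) • G x, v⟫)) := by
    have e : ∫ x in U, φ x * ⟪f (u x) • G x, v⟫
        = ∫ x, φ x * (f (U.indicator u x) * ⟪U.indicator G x, v⟫) := by
      rw [← integral_indicator hU.measurableSet]
      refine integral_congr_ae (Eventually.of_forall fun x => ?_)
      by_cases hx : x ∈ U
      · simp [hx, real_inner_smul_left]
      · simp [hx]
    have hGv : Integrable fun x => ⟪U.indicator G x, v⟫ := hG'.inner_const v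
    -- The product `f (w i) W i` is split: with the limit gradient in place of `W i`, dominated
    -- convergence applies since `f` is bounded and continuous. The remainder is controlled by the
    -- `L¹` error of `W i`.
    have hA : Tendsto (fun i => ∫ x, φ x * (f (w i x) * ⟪U.indicator G x, v⟫)) atTop
        (𝓝 (∫ x, φ x * (f (U.indicator u x) * ⟪U.indicator G x, v⟫))) := by
      refine tendsto_integral_of_dominated_convergence
        (fun x => K * (B * ‖⟪U.indicator G x, v⟫‖)) (fun i => ?_)
        ((hGv.norm.const_mul _).const_mul _) (fun i => Eventually.of_forall fun x => ?_) ?_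
      · exact hφ.smooth.continuous.aestronglyMeasurable.mul
          ((hf.comp (hw1 i).continuous).aestronglyMeasurable.mul hGv.aestronglyMeasurable)
      · rw [norm_mul, norm_mul]
        have hK0 : 0 ≤ K := (norm_nonneg _).trans (hK 0)
        exact mul_le_mul (hK x) (mul_le_mul_of_nonneg_right (hB _) (norm_nonneg _))
          (by positivity) hK0
      · filter_upwards [hw_ae] with x hx
        exact (((hf.tendsto _).comp hx).mul_const _).const_mul _
    have hD : Tendsto (fun i => ∫ x, φ x * (f (w i x) * ⟪W i x - U.indicator G x, v⟫)) atTop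
        (𝓝 0) := by
      have h0 : Tendsto (fun i => ENNReal.ofReal (K * B * ‖v‖) *
          ∫⁻ x, ‖W i x - U.indicator G x‖ₑ) atTop (𝓝 0) := by
        simpa using ENNReal.Tendsto.const_mul hW_L1 (Or.inr ENNReal.ofReal_ne_top)
      rw [tendsto_zero_iff_enorm_tendsto_zero]
      refine tendsto_of_tendsto_of_tendsto_of_le_of_le tendsto_const_nhds h0
        (fun _ => zero_le) fun i => ?_
      simp only
      rw [← lintegral_const_mul' _ _ ENNReal.ofReal_ne_top]
      refine (enorm_integral_le_lintegral_enorm _).trans (lintegral_mono fun x => ?_)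
      have hK0 : 0 ≤ K := (norm_nonneg _).trans (hK 0)
      rw [← ofReal_norm, ← ofReal_norm, ← ENNReal.ofReal_mul (by positivity), norm_mul, norm_mul]
      refine ENNReal.ofReal_le_ofReal ?_
      calc ‖φ x‖ * (‖f (w i x)‖ * ‖⟪W i x - U.indicator G x, v⟫‖)
          ≤ K * (B * (‖W i x - U.indicator G x‖ * ‖v‖)) := by
            gcongr
            · exact hK x
            · exact hB _
            · exact norm_inner_le_norm _ _
        _ = K * B * ‖v‖ * ‖W i x - U.indicator G x‖ := by ring
    rw [e]
    have := hA.add hD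
    rw [add_zero] at this
    refine this.congr fun i => ?_
    rw [← integral_add]
    · refine integral_congr_ae (Eventually.of_forall fun x => ?_)
      simp only [inner_sub_left]
      ring
    · exact integrable_smul_of_compactSupport hφ.smooth.continuous hφ.compact
        (hGv.bdd_mul (hf.comp (hw1 i).continuous).aestronglyMeasurable
          (Eventually.of_forall fun x => hB _))
    · have : Integrable fun x => φ x * (f (w i x) * ⟪W i x, v⟫) :=
        (hφ.smooth.continuous.mul ((hf.comp (hw1 i).continuous).mul
          ((hWc i).inner continuous_const))).integrable_of_hasCompactSupport hφ.compact.mul_right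
      have h2 : Integrable fun x => φ x * (f (w i x) * ⟪U.indicator G x, v⟫) :=
        integrable_smul_of_compactSupport hφ.smooth.continuous hφ.compact
          (hGv.bdd_mul (hf.comp (hw1 i).continuous).aestronglyMeasurable
            (Eventually.of_forall fun x => hB _))
      refine (this.sub h2).congr (Eventually.of_forall fun x => ?_)
      simp only [inner_sub_left, Pi.sub_apply]
      ring
  refine tendsto_nhds_unique hL ?_
  simp_rw [hid]
  exact hR.neg

end ChainRule

end SNPP

/-! ### Composition of Sobolev functions with Lipschitz functions -/

namespace SNPP

section Composition

/-- `f` is the pointwise limit of continuous functions that are bounded by `B`. -/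
def IsBoundedLimit (f : ℝ → ℝ) (B : ℝ) : Prop :=
  ∃ g : ℕ → ℝ → ℝ, (∀ k, Continuous (g k)) ∧ (∀ k s, |g k s| ≤ B) ∧
    ∀ s, Tendsto (fun k => g k s) atTop (𝓝 (f s))

theorem IsBoundedLimit.measurable {f : ℝ → ℝ} {B : ℝ} (h : IsBoundedLimit f B) :
    Measurable f := by
  obtain ⟨g, hg, -, hlim⟩ := h
  exact measurable_of_tendsto_metrizable (fun k => (hg k).measurable) (tendsto_pi_nhds.2 hlim)

theorem IsBoundedLimit.abs_le {f : ℝ → ℝ} {B : ℝ} (h : IsBoundedLimit f B) (s : ℝ) :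
    |f s| ≤ B := by
  obtain ⟨g, -, hB, hlim⟩ := h
  exact le_of_tendsto (hlim s).abs (Eventually.of_forall fun k => hB k s)

theorem IsBoundedLimit.nonneg {f : ℝ → ℝ} {B : ℝ} (h : IsBoundedLimit f B) : 0 ≤ B :=
  (abs_nonneg _).trans (h.abs_le 0)

/-- The approximants multiply `φ` by trapezoids of slope `k` that vanish at and beyond the
endpoints. Convergence thus holds at every point, including `a` and `b`, and the chain rule needs no
separate argument on level sets of `u`. -/
theorem isBoundedLimit_indicator {φ : ℝ → ℝ} (hφ : Continuous φ) {a b B : ℝ} (hB0 : 0 ≤ B)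
    (hB : ∀ s ∈ Ioo a b, |φ s| ≤ B) : IsBoundedLimit ((Ioo a b).indicator φ) B := by
  refine ⟨fun k s => min 1 (k * max 0 (min (s - a) (b - s))) * φ s, fun k => by fun_prop,
    fun k s => ?_, fun s => ?_⟩
  · by_cases hs : s ∈ Ioo a b
    · rw [abs_mul, abs_of_nonneg (by positivity)]
      calc _ ≤ 1 * B := mul_le_mul (min_le_left _ _) (hB s hs) (abs_nonneg _) zero_le_one
        _ = B := one_mul B
    · have : max 0 (min (s - a) (b - s)) = 0 := by
        rw [max_eq_left_iff, min_le_iff]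
        by_contra! hc
        exact hs ⟨by linarith, by linarith⟩
      simp [this, hB0]
  · by_cases hs : s ∈ Ioo a b
    · rw [indicator_of_mem hs]
      have hm : 0 < min (s - a) (b - s) := lt_min (by linarith [hs.1]) (by linarith [hs.2])
      obtain ⟨N, hN⟩ := exists_nat_gt (1 / min (s - a) (b - s))
      refine tendsto_const_nhds.congr' ?_
      filter_upwards [eventually_ge_atTop N] with k hk
      rw [max_eq_right hm.le, min_eq_left, one_mul]
      have : (N : ℝ) ≤ k := by exact_mod_cast hk
      rw [div_lt_iff₀ hm] at hN
      exact hN.le.trans (mul_le_mul_of_nonneg_right this hm.le)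
    · have : max 0 (min (s - a) (b - s)) = 0 := by
        rw [max_eq_left_iff, min_le_iff]
        by_contra! hc
        exact hs ⟨by linarith, by linarith⟩
      simp [this, hs]

/-- The primitive of `f` vanishing at the origin. -/
def primitive (f : ℝ → ℝ) (s : ℝ) : ℝ := ∫ r in (0:ℝ)..s, f r

theorem intervalIntegrable_of_abs_le {f : ℝ → ℝ} {B : ℝ} (hf : Measurable f)
    (hB : ∀ s, |f s| ≤ B) (a b : ℝ) : IntervalIntegrable f volume a b :=
  (intervalIntegrable_const (c := B)).mono_fun hf.aestronglyMeasurable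
    (Eventually.of_forall fun s => (hB s).trans (le_abs_self B))

theorem primitive_sub {f : ℝ → ℝ} {B : ℝ} (hf : Measurable f)
    (hB : ∀ s, |f s| ≤ B) (a b : ℝ) : primitive f b - primitive f a = ∫ r in a..b, f r :=
  intervalIntegral.integral_interval_sub_left (intervalIntegrable_of_abs_le hf hB _ _)
    (intervalIntegrable_of_abs_le hf hB _ _)

theorem abs_primitive_sub_le {f : ℝ → ℝ} {B : ℝ} (hf : Measurable f)
    (hB : ∀ s, |f s| ≤ B) (a b : ℝ) : |primitive f b - primitive f a| ≤ B * |b - a| := by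
  rw [primitive_sub hf hB]
  exact intervalIntegral.norm_integral_le_of_norm_le_const (f := f) fun s _ => hB s

@[simp]
theorem primitive_zero (f : ℝ → ℝ) : primitive f 0 = 0 := intervalIntegral.integral_same

theorem abs_primitive_le {f : ℝ → ℝ} {B : ℝ} (hf : Measurable f)
    (hB : ∀ s, |f s| ≤ B) (s : ℝ) : |primitive f s| ≤ B * |s| := by
  simpa using abs_primitive_sub_le hf hB 0 s

theorem continuous_primitive {f : ℝ → ℝ} {B : ℝ} (hf : Measurable f)
    (hB : ∀ s, |f s| ≤ B) : Continuous (primitive f) :=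
  intervalIntegral.continuous_primitive (intervalIntegrable_of_abs_le hf hB) 0

theorem hasDerivAt_primitive {f : ℝ → ℝ} (hf : Continuous f) (s : ℝ) :
    HasDerivAt (primitive f) (f s) s :=
  intervalIntegral.integral_hasDerivAt_right (hf.intervalIntegrable _ _)
    (hf.stronglyMeasurableAtFilter _ _) hf.continuousAt

variable {n : ℕ} {U : Set (E n)} {u : E n → ℝ} {G : E n → E n}

/-- Chain rule for the primitive of a bounded limit of continuous functions. -/
theorem IsWeakGradient.primitive_comp (hU : IsOpen U) (h : IsWeakGradient U u G)
    (hu : IntegrableOn u U) (hG : IntegrableOn G U) {f : ℝ → ℝ} {B : ℝ}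
    (hf : IsBoundedLimit f B) :
    IsWeakGradient U (fun x => primitive f (u x)) (fun x => f (u x) • G x) := by
  obtain ⟨g, hg, hgB, hlim⟩ := hf
  have hB0 : 0 ≤ B := (abs_nonneg _).trans (hgB 0 0)
  have i1 : ∀ k, IntegrableOn (fun x => primitive (g k) (u x)) U := fun k =>
    (hu.norm.const_mul B).mono'
      ((continuous_primitive (hg k).measurable (hgB k)).comp_aestronglyMeasurable
        hu.aestronglyMeasurable)
      (Eventually.of_forall fun x => abs_primitive_le (hg k).measurable (hgB k) _)
  have i2 : ∀ k, IntegrableOn (fun x => g k (u x) • G x) U := fun k =>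
    hG.bdd_smul B ((hg k).comp_aestronglyMeasurable hu.aestronglyMeasurable)
      (Eventually.of_forall fun x => hgB k _)
  intro φ hφ
  have hk : ∀ k, ∫ x in U, primitive (g k) (u x) • gradient φ x
      = - ∫ x in U, φ x • (g k (u x) • G x) := fun k =>
    h.comp_of_continuous hU hu hG (hasDerivAt_primitive (hg k)) (hg k) (hgB k) (i1 k) (i2 k) φ hφ
  obtain ⟨K, hK⟩ := hφ.compact.exists_abs_le hφ.smooth.continuous
  obtain ⟨K', hK'⟩ := hφ.continuous_gradient.bounded_above_of_compact_support
    hφ.compact_gradient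
  have hK0 : 0 ≤ K := (norm_nonneg _).trans (hK 0)
  have hK'0 : 0 ≤ K' := (norm_nonneg _).trans (hK' 0)
  have hL : Tendsto (fun k => ∫ x in U, primitive (g k) (u x) • gradient φ x) atTop
      (𝓝 (∫ x in U, primitive f (u x) • gradient φ x)) := by
    refine tendsto_integral_of_dominated_convergence (fun x => B * ‖u x‖ * K') (fun k => ?_)
      ((hu.norm.const_mul B).mul_const K') (fun k => Eventually.of_forall fun x => ?_)
      (Eventually.of_forall fun x => ?_)
    · exact (i1 k).aestronglyMeasurable.smul hφ.continuous_gradient.aestronglyMeasurable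
    · rw [norm_smul]
      exact mul_le_mul (abs_primitive_le (hg k).measurable (hgB k) _) (hK' x) (norm_nonneg _)
        (by positivity)
    · refine Tendsto.smul_const ?_ _
      -- Convergence of the derivatives passes to the primitives because all of them are bounded by
      -- `B` on the interval between `0` and `u x`.
      refine intervalIntegral.tendsto_integral_filter_of_dominated_convergence (fun _ => B)
        (Eventually.of_forall fun k => (hg k).aestronglyMeasurable)
        (Eventually.of_forall fun k => Eventually.of_forall fun s _ => hgB k s)
        intervalIntegrable_const (Eventually.of_forall fun s _ => hlim s)
  have hR : Tendsto (fun k => ∫ x in U, φ x • (g k (u x) • G x)) atTop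
      (𝓝 (∫ x in U, φ x • (f (u x) • G x))) := by
    refine tendsto_integral_of_dominated_convergence (fun x => K * (B * ‖G x‖)) (fun k => ?_)
      ((hG.norm.const_mul B).const_mul K) (fun k => Eventually.of_forall fun x => ?_)
      (Eventually.of_forall fun x => ((hlim (u x)).smul_const _).const_smul _)
    · exact hφ.smooth.continuous.aestronglyMeasurable.smul (i2 k).aestronglyMeasurable
    · rw [norm_smul, norm_smul]
      exact mul_le_mul (hK x) (mul_le_mul_of_nonneg_right (hgB k _) (norm_nonneg _))
        (by positivity) hK0
  refine tendsto_nhds_unique hL ?_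
  simp_rw [hk]
  exact hR.neg

theorem H1.isWeakGradient (u : H1 U) : IsWeakGradient U u.fn u.grad := u.2

/-- An element of `H¹(U)` from a square integrable function and its weak gradient. -/
theorem H1.exists_of_isWeakGradient (hu : MemLp u 2 (volume.restrict U))
    (hG : MemLp G 2 (volume.restrict U)) (h : IsWeakGradient U u G) :
    ∃ w : H1 U, w.fn =ᵐ[volume.restrict U] u ∧ w.grad =ᵐ[volume.restrict U] G := by
  refine ⟨⟨WithLp.toLp 2 (hu.toLp, hG.toLp), fun φ hφ => ?_⟩, hu.coeFn_toLp, hG.coeFn_toLp⟩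
  have e1 : ∫ x in U, (hu.toLp : E n → ℝ) x • gradient φ x = ∫ x in U, u x • gradient φ x := by
    refine integral_congr_ae ?_
    filter_upwards [hu.coeFn_toLp] with x hx
    rw [hx]
  have e2 : ∫ x in U, φ x • (hG.toLp : E n → E n) x = ∫ x in U, φ x • G x := by
    refine integral_congr_ae ?_
    filter_upwards [hG.coeFn_toLp] with x hx
    rw [hx]
  exact e1.trans ((h φ hφ).trans (congrArg Neg.neg e2.symm))

/-- `F ∘ u ∈ H¹(U)` for the primitive `F` of a bounded limit of continuous functions. -/
theorem H1.exists_primitive_comp (hU : IsOpen U) (hfin : volume U ≠ ⊤) (u : H1 U) {f : ℝ → ℝ}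
    {B : ℝ} (hf : IsBoundedLimit f B) :
    ∃ w : H1 U, (w.fn =ᵐ[volume.restrict U] fun x => primitive f (u.fn x)) ∧
      (w.grad =ᵐ[volume.restrict U] fun x => f (u.fn x) • u.grad x) := by
  have : IsFiniteMeasure (volume.restrict U) := isFiniteMeasure_restrict.2 hfin
  have m1 : AEStronglyMeasurable (fun x => primitive f (u.fn x)) (volume.restrict U) :=
    (continuous_primitive hf.measurable hf.abs_le).comp_aestronglyMeasurable
      (Lp.memLp u.fn).aestronglyMeasurable
  have m2 : AEStronglyMeasurable (fun x => f (u.fn x) • u.grad x) (volume.restrict U) :=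
    (hf.measurable.comp_aemeasurable
      (Lp.memLp u.fn).aestronglyMeasurable.aemeasurable).aestronglyMeasurable.smul
      (Lp.memLp u.grad).aestronglyMeasurable
  refine H1.exists_of_isWeakGradient ?_ ?_ (u.isWeakGradient.primitive_comp hU
    ((Lp.memLp u.fn).integrable one_le_two) ((Lp.memLp u.grad).integrable one_le_two) hf)
  · exact (Lp.memLp u.fn).of_le_mul (c := B) m1 (Eventually.of_forall fun x =>
      abs_primitive_le hf.measurable hf.abs_le _)
  · refine (Lp.memLp u.grad).of_le_mul (c := B) m2 (Eventually.of_forall fun x => ?_)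
    rw [norm_smul]
    exact mul_le_mul_of_nonneg_right (hf.abs_le _) (norm_nonneg _)

/-- The norm of `F ∘ u` in `H¹(U)`, `F` being the primitive of `f`. -/
theorem H1.norm_le_of_primitive_comp {u w : H1 U} {f : ℝ → ℝ} {B : ℝ} (hf : IsBoundedLimit f B)
    (h1 : w.fn =ᵐ[volume.restrict U] fun x => primitive f (u.fn x))
    (h2 : w.grad =ᵐ[volume.restrict U] fun x => f (u.fn x) • u.grad x) :
    ‖w‖ ≤ B * ‖u‖ := by
  have n1 : ‖w.fn‖ ≤ B * ‖u.fn‖ := by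
    refine Lp.norm_le_mul_norm_of_ae_le_mul ?_
    filter_upwards [h1] with x hx
    rw [hx]
    exact abs_primitive_le hf.measurable hf.abs_le _
  have n2 : ‖w.grad‖ ≤ B * ‖u.grad‖ := by
    refine Lp.norm_le_mul_norm_of_ae_le_mul ?_
    filter_upwards [h2] with x hx
    rw [hx, norm_smul]
    exact mul_le_mul_of_nonneg_right (hf.abs_le _) (norm_nonneg _)
  have hB0 := hf.nonneg
  have s : ∀ z : H1 U, ‖z‖ ^ 2 = ‖z.fn‖ ^ 2 + ‖z.grad‖ ^ 2 := fun z =>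
    WithLp.prod_norm_sq_eq_of_L2 (z : WithLp 2 (L2 U × L2Vec U))
  refine abs_le_of_sq_le_sq' ?_ (by positivity) |>.2
  rw [s w, mul_pow, s u, mul_add, ← mul_pow, ← mul_pow]
  gcongr

end Composition

end SNPP

/-! ### Weak time derivatives and the energy inequality -/

namespace SNPP

section Time

open scoped Convolution ENNReal

/-- A continuous function with an integrable weak derivative is its primitive. -/
theorem sub_eq_integral_of_weakDeriv {T : ℝ} {f k : ℝ → ℝ} (hf : ContinuousOn f (Icc 0 T))
    (hk : IntegrableOn k (Ioo 0 T))
    (h : ∀ η : ℝ → ℝ, ContDiff ℝ ∞ η → HasCompactSupport η → tsupport η ⊆ Ioo 0 T →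
      ∫ t in Ioo 0 T, deriv η t * f t = - ∫ t in Ioo 0 T, η t * k t)
    {a b : ℝ} (ha : 0 < a) (hab : a < b) (hb : b < T) : f b - f a = ∫ t in a..b, k t := by
  obtain ⟨δ, hδ, hδa, hδb⟩ : ∃ δ > 0, δ < a ∧ δ < T - b :=
    ⟨min a (T - b) / 2, by have : 0 < min a (T - b) := lt_min ha (by linarith)
                           positivity,
      by linarith [min_le_left a (T - b), ha, lt_min ha (sub_pos.2 hb)],
      by linarith [min_le_right a (T - b), ha, lt_min ha (sub_pos.2 hb)]⟩
  let φ : ℕ → ContDiffBump (0 : ℝ) := fun i =>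
    ⟨δ / (2 * (i + 2)), δ / (i + 2), by positivity,
      by gcongr; linarith [show (0:ℝ) ≤ i by positivity]⟩
  have hφ0 : Tendsto (fun i => (φ i).rOut) atTop (𝓝 0) := by
    have : Tendsto (fun i : ℕ => (i : ℝ) + 2) atTop atTop :=
      tendsto_natCast_atTop_atTop.atTop_add tendsto_const_nhds
    exact Tendsto.div_atTop tendsto_const_nhds this
  have hφδ : ∀ i, (φ i).rOut ≤ δ := fun i =>
    div_le_self hδ.le (by linarith [show (0:ℝ) ≤ i by positivity])
  let ρ : ℕ → ℝ → ℝ := fun i => (φ i).normed volume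
  have hρc : ∀ i, Continuous (ρ i) := fun i => (φ i).continuous_normed
  have hρ0 : ∀ i x, (φ i).rOut ≤ |x| → ρ i x = 0 := by
    intro i x hx
    have : x ∉ Function.support ((φ i).normed volume) := by
      rw [(φ i).support_normed_eq, mem_ball_zero_iff]
      exact not_lt.2 hx
    simpa using this
  -- A smoothed indicator of `(a, b)`. Its derivative is a bump at `a` minus a bump at `b`, so
  -- testing with it yields `f a - f b` on one side and `-∫ k` over `(a, b)` on the other.
  let η : ℕ → ℝ → ℝ := fun i s => primitive (ρ i) (s - a) - primitive (ρ i) (s - b)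
  have hη_int : ∀ i s, η i s = ∫ r in (s - b)..(s - a), ρ i r := fun i s =>
    intervalIntegral.integral_interval_sub_left ((hρc i).intervalIntegrable _ _)
      ((hρc i).intervalIntegrable _ _)
  have hη_deriv : ∀ i s, HasDerivAt (η i) (ρ i (s - a) - ρ i (s - b)) s := fun i s =>
    ((hasDerivAt_primitive (hρc i) (s - a)).comp_sub_const s a).sub
      ((hasDerivAt_primitive (hρc i) (s - b)).comp_sub_const s b)
  have hη_smooth : ∀ i, ContDiff ℝ ∞ (η i) := by
    intro i
    rw [contDiff_infty_iff_deriv]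
    refine ⟨fun s => (hη_deriv i s).differentiableAt, ?_⟩
    rw [show deriv (η i) = fun s => ρ i (s - a) - ρ i (s - b) from
      funext fun s => (hη_deriv i s).deriv]
    have : ContDiff ℝ ∞ (ρ i) := (φ i).contDiff_normed (n := ⊤)
    exact (this.comp (contDiff_id.sub contDiff_const)).sub
      (this.comp (contDiff_id.sub contDiff_const))
  have hη_zero : ∀ i s, s ∉ Icc (a - (φ i).rOut) (b + (φ i).rOut) → η i s = 0 := by
    intro i s hs
    rw [hη_int, intervalIntegral.integral_congr (g := fun _ => 0), intervalIntegral.integral_zero]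
    intro r hr
    rw [uIcc_of_le (by linarith)] at hr
    refine hρ0 i r ?_
    rw [mem_Icc, not_and_or, not_le, not_le] at hs
    rcases hs with hs | hs
    · rw [abs_of_neg (by linarith [hr.2, (φ i).rOut_pos])]; linarith [hr.2]
    · rw [abs_of_pos (by linarith [hr.1, (φ i).rOut_pos])]; linarith [hr.1]
  have hη_supp : ∀ i, tsupport (η i) ⊆ Icc (a - δ) (b + δ) := by
    intro i
    refine closure_minimal (fun s hs => ?_) isClosed_Icc
    by_contra hs'
    exact hs (hη_zero i s fun h' => hs' ⟨by linarith [h'.1, hφδ i], by linarith [h'.2, hφδ i]⟩)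
  have hη_cs : ∀ i, HasCompactSupport (η i) := fun i =>
    isCompact_Icc.of_isClosed_subset (isClosed_tsupport _) (hη_supp i)
  have hη_sub : ∀ i, tsupport (η i) ⊆ Ioo 0 T := fun i s hs =>
    ⟨by linarith [(hη_supp i hs).1], by linarith [(hη_supp i hs).2]⟩
  have hη_le : ∀ i s, ‖η i s‖ ≤ 1 := by
    intro i s
    have hn : ∀ r, 0 ≤ ρ i r := (φ i).nonneg_normed
    rw [hη_int, intervalIntegral.integral_of_le (by linarith), Real.norm_of_nonneg
      (setIntegral_nonneg measurableSet_Ioc fun r _ => hn r)]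
    exact (setIntegral_le_integral (φ i).integrable_normed (Eventually.of_forall hn)).trans_eq
      (φ i).integral_normed
  have hη_lim : ∀ s, s ≠ a → s ≠ b →
      Tendsto (fun i => η i s) atTop (𝓝 ((Ioc a b).indicator (fun _ => (1:ℝ)) s)) := by
    intro s hsa hsb
    refine tendsto_const_nhds.congr' ?_
    have hm : 0 < min |s - a| |s - b| :=
      lt_min (abs_pos.2 (sub_ne_zero.2 hsa)) (abs_pos.2 (sub_ne_zero.2 hsb))
    filter_upwards [(tendsto_order.1 hφ0).2 _ hm] with i hi
    have hia := hi.trans_le (min_le_left _ _)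
    have hib := hi.trans_le (min_le_right _ _)
    by_cases hs : s ∈ Ioc a b
    · rw [indicator_of_mem hs, hη_int, intervalIntegral.integral_eq_integral_of_support_subset]
      · exact (φ i).integral_normed.symm
      · intro r hr
        have hr' : |r| < (φ i).rOut := by
          by_contra hc
          exact hr (hρ0 i r (not_lt.1 hc))
        rw [abs_lt] at hr'
        rw [abs_of_pos (by linarith [hs.1])] at hia
        rw [abs_of_nonpos (by linarith [hs.2])] at hib
        exact ⟨by linarith, by linarith⟩
    · rw [indicator_of_notMem hs, hη_zero i s]
      intro hs'
      rw [mem_Ioc, not_and_or, not_lt, not_le] at hs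
      rcases hs with hs | hs
      · rw [abs_of_nonpos (by linarith)] at hia
        linarith [hs'.1]
      · rw [abs_of_pos (by linarith : (0:ℝ) < s - b)] at hib
        linarith [hs'.2]
  have hR : Tendsto (fun i => ∫ t in Ioo 0 T, η i t * k t) atTop (𝓝 (∫ t in a..b, k t)) := by
    have e : ∫ t in a..b, k t = ∫ t in Ioo 0 T, (Ioc a b).indicator (fun _ => (1:ℝ)) t * k t := by
      rw [intervalIntegral.integral_of_le hab.le]
      have : (fun t => (Ioc a b).indicator (fun _ => (1:ℝ)) t * k t) = (Ioc a b).indicator k := by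
        funext t
        by_cases ht : t ∈ Ioc a b <;> simp [ht]
      rw [this, setIntegral_indicator measurableSet_Ioc, inter_eq_self_of_subset_right]
      exact fun t ht => ⟨ha.trans ht.1, ht.2.trans_lt hb⟩
    rw [e]
    refine tendsto_integral_of_dominated_convergence (fun t => ‖k t‖) (fun i => ?_) hk.norm
      (fun i => Eventually.of_forall fun t => ?_) ?_
    · exact (hη_smooth i).continuous.aestronglyMeasurable.mul hk.aestronglyMeasurable
    · rw [norm_mul]
      exact mul_le_of_le_one_left (norm_nonneg _) (hη_le i t)
    · refine ae_restrict_of_ae ?_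
      filter_upwards [compl_mem_ae_iff.2 (measure_singleton (μ := (volume : Measure ℝ)) a),
        compl_mem_ae_iff.2 (measure_singleton (μ := (volume : Measure ℝ)) b)] with t hta htb
      exact (hη_lim t hta htb).mul_const _
  -- Extension by zero makes `f` integrable on the line without changing it near the interior points
  -- `a` and `b`.
  let w : ℝ → ℝ := (Ioo 0 T).indicator f
  have hwi : Integrable w := (integrable_indicator_iff measurableSet_Ioo).2
    ((hf.integrableOn_Icc).mono_set Ioo_subset_Icc_self)
  have hlim : ∀ c ∈ Ioo 0 T, Tendsto (fun i => ∫ t, ρ i (t - c) * w t) atTop (𝓝 (f c)) := by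
    intro c hc
    have hcont : ContinuousAt w c := by
      have : ContinuousAt f c := hf.continuousAt (Icc_mem_nhds hc.1 hc.2)
      refine this.congr ?_
      filter_upwards [isOpen_Ioo.mem_nhds hc] with t ht
      exact (indicator_of_mem ht f).symm
    have := ContDiffBump.convolution_tendsto_right (μ := volume) (φ := φ) (g := fun _ => w)
      (k := fun _ => c) (z₀ := w c) hφ0
      (Eventually.of_forall fun _ => hwi.aestronglyMeasurable)
      (hcont.tendsto.comp tendsto_snd) tendsto_const_nhds
    rw [show f c = w c from (indicator_of_mem hc f).symm]
    refine this.congr fun i => ?_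
    rw [convolution_eq_swap]
    refine integral_congr_ae (Eventually.of_forall fun t => ?_)
    simp only [ContinuousLinearMap.lsmul_apply, smul_eq_mul]
    -- The bump is even, so integrating against its shift is a convolution evaluated at `c`.
    rw [← (φ i).normed_neg, neg_sub]
  have hint : ∀ i c, Integrable fun t => ρ i (t - c) * w t := by
    intro i c
    obtain ⟨K, hK⟩ := (φ i).continuous_normed.bounded_above_of_compact_support
      ((φ i).hasCompactSupport_normed (μ := volume))
    exact hwi.bdd_mul ((hρc i).comp (continuous_id.sub continuous_const)).aestronglyMeasurable
      (Eventually.of_forall fun t => hK (t - c))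
  have hL := (hlim a ⟨ha, hab.trans hb⟩).sub (hlim b ⟨ha.trans hab, hb⟩)
  have hLR : ∀ i, (∫ t, ρ i (t - a) * w t) - ∫ t, ρ i (t - b) * w t
      = - ∫ t in Ioo 0 T, η i t * k t := by
    intro i
    rw [← h (η i) (hη_smooth i) (hη_cs i) (hη_sub i), ← integral_sub (hint i a) (hint i b),
      ← integral_indicator measurableSet_Ioo]
    refine integral_congr_ae (Eventually.of_forall fun t => ?_)
    by_cases ht : t ∈ Ioo 0 T
    · simp only [w, indicator_of_mem ht, (hη_deriv i t).deriv]; ring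
    · simp [w, indicator_of_notMem ht]
  simp_rw [hLR] at hL
  have := tendsto_nhds_unique hL hR.neg
  linarith

/-- The oscillation of `g` over the time interval `(t - τ, t)`, weighted by `b`. -/
def oscillation {Y : Type*} [NormedAddCommGroup Y] (b : ℝ → ℝ) (g : ℝ → Y) (τ t : ℝ) : ℝ≥0∞ :=
  ‖b t‖ₑ * ∫⁻ θ in Ioo 0 τ, ‖g (t - θ) - g t‖ₑ

section Oscillation

variable {Y : Type*} [NormedAddCommGroup Y] {g : ℝ → Y} {b : ℝ → ℝ}

theorem oscillation_eq_lintegral (b : ℝ → ℝ) (g : ℝ → Y) (τ t : ℝ) :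
    oscillation b g τ t = ∫⁻ θ in Ioo 0 τ, ‖b t‖ₑ * ‖g (t - θ) - g t‖ₑ := by
  rw [oscillation, lintegral_const_mul' _ _ enorm_ne_top]

theorem aemeasurable_uncurry_oscillation (hg : AEStronglyMeasurable g)
    (hb : AEStronglyMeasurable b) (τ : ℝ) :
    AEMeasurable (Function.uncurry fun (t θ : ℝ) => ‖b t‖ₑ * ‖g (t - θ) - g t‖ₑ)
      ((volume : Measure ℝ).prod (volume.restrict (Ioo 0 τ))) := by
  have hm' : AEMeasurable (Function.uncurry fun (t θ : ℝ) => ‖b t‖ₑ * ‖g (t - θ) - g t‖ₑ)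
      ((volume : Measure ℝ).prod volume) := by
    have h1 : AEMeasurable (fun p : ℝ × ℝ => ‖b p.1‖ₑ) ((volume : Measure ℝ).prod volume) :=
      hb.comp_fst.enorm
    refine h1.mul (AEStronglyMeasurable.enorm ?_)
    refine AEStronglyMeasurable.sub ?_ hg.comp_fst
    exact hg.comp_quasiMeasurePreserving (quasiMeasurePreserving_sub volume volume)
  refine hm'.mono_measure ?_
  rw [← Measure.restrict_univ (μ := (volume : Measure ℝ)), Measure.prod_restrict,
    Measure.restrict_univ]
  exact Measure.restrict_le_self

theorem aemeasurable_oscillation (hg : AEStronglyMeasurable g) (hb : AEStronglyMeasurable b)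
    (τ : ℝ) : AEMeasurable (oscillation b g τ) := by
  rw [funext (oscillation_eq_lintegral b g τ)]
  exact (aemeasurable_uncurry_oscillation hg hb τ).lintegral_prod_right'

/-- The integral of the oscillation of an `L²` function over time intervals of length `τ` is
`o(τ)`. -/
theorem eventually_lintegral_oscillation_le (hg : MemLp g 2) (hb : MemLp b 2) {η : ℝ≥0∞}
    (hη : 0 < η) :
    ∀ᶠ τ in 𝓝[>] (0:ℝ), ∫⁻ t, oscillation b g τ t ≤ η * ENNReal.ofReal τ := by
  have h0 : Tendsto (fun θ => eLpNorm b 2 * eLpNorm (fun t => g (t - θ) - g t) 2) (𝓝 0) (𝓝 0) := by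
    simpa using ENNReal.Tendsto.const_mul
      (tendsto_eLpNorm_translate_sub (μ := volume) ENNReal.ofNat_ne_top hg)
      (Or.inr hb.eLpNorm_ne_top)
  obtain ⟨δ, hδ, hball⟩ := Metric.eventually_nhds_iff.1 (ENNReal.tendsto_nhds_zero.1 h0 η hη)
  filter_upwards [Ioo_mem_nhdsGT hδ] with τ hτ
  calc ∫⁻ t, oscillation b g τ t
      = ∫⁻ t, ∫⁻ θ in Ioo 0 τ, ‖b t‖ₑ * ‖g (t - θ) - g t‖ₑ :=
        lintegral_congr (oscillation_eq_lintegral b g τ)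
    _ = ∫⁻ θ in Ioo 0 τ, ∫⁻ t, ‖b t‖ₑ * ‖g (t - θ) - g t‖ₑ := lintegral_lintegral_swap
        (aemeasurable_uncurry_oscillation hg.aestronglyMeasurable hb.aestronglyMeasurable τ)
    _ ≤ ∫⁻ _ in Ioo 0 τ, η := by
        refine setLIntegral_mono' measurableSet_Ioo fun θ hθ => ?_
        have hs : AEStronglyMeasurable (fun t => g (t - θ) - g t) volume :=
          (hg.aestronglyMeasurable.comp_measurePreserving
            (measurePreserving_sub_right volume θ)).sub hg.aestronglyMeasurable
        -- For fixed `θ`, Cauchy-Schwarz in `t` leaves the `L²` translation error of `g`, small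
        -- uniformly in `θ < τ`. The remaining integral over `θ` produces the factor `τ`.
        have hH := ENNReal.lintegral_mul_le_Lp_mul_Lq volume Real.HolderConjugate.two_two
          hb.aestronglyMeasurable.enorm hs.enorm
        have hd : dist θ 0 < δ := by
          rw [Real.dist_0_eq_abs, abs_of_pos hθ.1]
          exact hθ.2.trans hτ.2
        refine le_trans (hH.trans_eq ?_) (hball hd)
        rw [eLpNorm_eq_lintegral_rpow_enorm_toReal two_ne_zero ENNReal.ofNat_ne_top,
          eLpNorm_eq_lintegral_rpow_enorm_toReal two_ne_zero ENNReal.ofNat_ne_top]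
        simp
    _ = η * ENNReal.ofReal τ := by simp

end Oscillation

/-- Substituting `r = t - θ` and using the operator norm, only `‖ψ‖ ≤ b t` matters. The test vector
may therefore be chosen separately for each `t`, with no measurable dependence on time. -/
theorem ofReal_integral_apply_sub_le {X : Type*} [NormedAddCommGroup X] [NormedSpace ℝ X]
    (g : ℝ → StrongDual ℝ X) {b : ℝ → ℝ} {t τ : ℝ} (hτ : 0 < τ) {ψ : X} (hψ : ‖ψ‖ ≤ b t) :
    ENNReal.ofReal (∫ r in (t - τ)..t, (g r - g t) ψ) ≤ oscillation b g τ t := by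
  have e : ∫⁻ θ in Ioo 0 τ, ‖g (t - θ) - g t‖ₑ = ∫⁻ r in Ioo (t - τ) t, ‖g r - g t‖ₑ := by
    rw [← lintegral_indicator measurableSet_Ioo, ← lintegral_indicator measurableSet_Ioo,
      ← lintegral_sub_left_eq_self ((Ioo (t - τ) t).indicator _) t]
    refine lintegral_congr fun θ => ?_
    by_cases hθ : θ ∈ Ioo 0 τ
    · have : t - θ ∈ Ioo (t - τ) t := ⟨by linarith [hθ.2], by linarith [hθ.1]⟩
      rw [indicator_of_mem hθ, indicator_of_mem this]
    · have : t - θ ∉ Ioo (t - τ) t := fun h' => hθ ⟨by linarith [h'.2], by linarith [h'.1]⟩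
      rw [indicator_of_notMem hθ, indicator_of_notMem this]
  rw [oscillation, e, intervalIntegral.integral_of_le (by linarith), integral_Ioc_eq_integral_Ioo,
    ← lintegral_const_mul' _ _ enorm_ne_top]
  have h1 : ∀ x : ℝ, ENNReal.ofReal x ≤ ‖x‖ₑ := fun x => by
    rw [← ofReal_norm]
    exact ENNReal.ofReal_le_ofReal (le_abs_self x)
  refine (h1 _).trans ((enorm_integral_le_lintegral_enorm _).trans (lintegral_mono fun r => ?_))
  rw [← ofReal_norm, ← ofReal_norm, ← ofReal_norm, ← ENNReal.ofReal_mul (norm_nonneg _)]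
  refine ENNReal.ofReal_le_ofReal (((g r - g t).le_opNorm ψ).trans ?_)
  rw [mul_comm]
  exact mul_le_mul_of_nonneg_right (hψ.trans (le_abs_self _)) (norm_nonneg _)

theorem integral_le_toReal_lintegral {α : Type*} [MeasurableSpace α] {μ : Measure α} {f : α → ℝ}
    (hf : Integrable f μ) : ∫ x, f x ∂μ ≤ (∫⁻ x, ENNReal.ofReal (f x) ∂μ).toReal := by
  rw [integral_eq_lintegral_pos_part_sub_lintegral_neg_part hf]
  linarith [ENNReal.toReal_nonneg (a := ∫⁻ x, ENNReal.ofReal (-f x) ∂μ)]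

instance isFiniteMeasure_timeMeasure (T : ℝ) : IsFiniteMeasure (timeMeasure T) :=
  isFiniteMeasure_restrict.2 (by simp)

theorem _root_.MeasureTheory.MemLp.indicator_Ioo {Y : Type*} [NormedAddCommGroup Y] {w : ℝ → Y}
    {T : ℝ} {p : ℝ≥0∞} (hw : MemLp w p (timeMeasure T)) :
    MemLp ((Ioo 0 T).indicator w) p := by
  rw [timeMeasure] at hw
  rwa [memLp_indicator_iff_restrict measurableSet_Ioo]

/-- Splitting of the mean value of a functional into its current value and an oscillation. -/
theorem integral_apply_eq_integral_sub_add {X : Type*} [NormedAddCommGroup X] [NormedSpace ℝ X]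
    {T : ℝ} {g : ℝ → StrongDual ℝ X} (hg : Integrable g (timeMeasure T)) {t τ : ℝ}
    (hτ : 0 < τ) (htτ : τ < t) (htT : t < T) (ψ : X) :
    ∫ r in (t - τ)..t, g r ψ =
      (∫ r in (t - τ)..t, ((Ioo 0 T).indicator g r - (Ioo 0 T).indicator g t) ψ) + τ * g t ψ := by
  have htm : t ∈ Ioo 0 T := ⟨hτ.trans htτ, htT⟩
  have hgi : IntervalIntegrable (fun r => g r ψ) volume (t - τ) t := by
    rw [intervalIntegrable_iff_integrableOn_Ioo_of_le (by linarith)]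
    have h2 : IntegrableOn (fun r => g r ψ) (Ioo 0 T) := hg.apply_continuousLinearMap ψ
    exact h2.mono_set fun r hr => ⟨by linarith [hr.1], by linarith [hr.2]⟩
  have : ∫ r in (t - τ)..t, ((Ioo 0 T).indicator g r - (Ioo 0 T).indicator g t) ψ
      = ∫ r in (t - τ)..t, (g r ψ - g t ψ) := by
    rw [intervalIntegral.integral_of_le (by linarith),
      intervalIntegral.integral_of_le (by linarith)]
    refine setIntegral_congr_fun measurableSet_Ioc fun r hr => ?_
    have hrm : r ∈ Ioo 0 T := ⟨by linarith [hr.1], by linarith [hr.2]⟩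
    simp only [indicator_of_mem hrm, indicator_of_mem htm, _root_.sub_apply]
  rw [this, intervalIntegral.integral_sub hgi intervalIntegrable_const]
  simp

/-- A continuous function that exceeds its initial value has large mean increments. -/
theorem eventually_le_integral_increment {T : ℝ} {e : ℝ → ℝ} (he : ContinuousOn e (Icc 0 T))
    {t₀ : ℝ} (ht₀ : t₀ ∈ Ioc 0 T) (hlt : e 0 < e t₀) :
    ∀ᶠ τ in 𝓝[>] (0:ℝ), τ < t₀ ∧ IntegrableOn (fun t => e t - e (t - τ)) (Ioo τ t₀) ∧
      τ * ((e t₀ - e 0) / 3) ≤ ∫ t in Ioo τ t₀, (e t - e (t - τ)) := by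
  set d := e t₀ - e 0 with hd
  have hd0 : 0 < d := sub_pos.2 hlt
  have h0T : (0:ℝ) ∈ Icc 0 T := ⟨le_rfl, ht₀.1.le.trans ht₀.2⟩
  have ht₀' : t₀ ∈ Icc 0 T := ⟨ht₀.1.le, ht₀.2⟩
  obtain ⟨δ₀, hδ₀, hc₀⟩ := Metric.continuousWithinAt_iff.1 (he 0 h0T) (d / 3) (by positivity)
  obtain ⟨δ₁, hδ₁, hc₁⟩ := Metric.continuousWithinAt_iff.1 (he t₀ ht₀') (d / 3) (by positivity)
  filter_upwards [Ioo_mem_nhdsGT (lt_min (lt_min hδ₀ hδ₁) ht₀.1)] with τ hτ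
  obtain ⟨hτ0, hτlt⟩ := hτ
  have hτδ₀ : τ < δ₀ := hτlt.trans_le ((min_le_left _ _).trans (min_le_left _ _))
  have hτδ₁ : τ < δ₁ := hτlt.trans_le ((min_le_left _ _).trans (min_le_right _ _))
  have hτt₀ : τ < t₀ := hτlt.trans_le (min_le_right _ _)
  have hint : ∀ a b, a ∈ Icc 0 T → b ∈ Icc 0 T → IntervalIntegrable e volume a b :=
    fun a b ha hb => (he.mono (uIcc_subset_Icc ha hb)).intervalIntegrable
  have m1 : τ ∈ Icc 0 T := ⟨hτ0.le, hτt₀.le.trans ht₀.2⟩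
  have m2 : t₀ - τ ∈ Icc 0 T := ⟨by linarith, by linarith [ht₀.2]⟩
  have hint' : IntervalIntegrable (fun t => e (t - τ)) volume τ t₀ := by
    simpa using (hint 0 (t₀ - τ) h0T m2).comp_sub_right τ
  refine ⟨hτt₀, (intervalIntegrable_iff_integrableOn_Ioo_of_le hτt₀.le).1
    ((hint _ _ m1 ht₀').sub hint'), ?_⟩
  -- The shifted integrals telescope to `∫ e` over `(t₀ - τ, t₀)` minus `∫ e` over `(0, τ)`. By
  -- continuity each mean is within `d / 3` of its endpoint value, so a gap of `d / 3` survives.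
  rw [← integral_Ioc_eq_integral_Ioo, ← intervalIntegral.integral_of_le hτt₀.le,
    intervalIntegral.integral_sub (hint _ _ m1 ht₀') hint',
    intervalIntegral.integral_comp_sub_right e τ, sub_self]
  have a1 := intervalIntegral.integral_add_adjacent_intervals (hint 0 τ h0T m1)
    (hint τ t₀ m1 ht₀')
  have a2 := intervalIntegral.integral_add_adjacent_intervals (hint 0 (t₀ - τ) h0T m2)
    (hint (t₀ - τ) t₀ m2 ht₀')
  have l1 : τ * (e t₀ - d / 3) ≤ ∫ t in (t₀ - τ)..t₀, e t := by
    have := intervalIntegral.integral_mono_on (a := t₀ - τ) (b := t₀) (μ := volume)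
      (f := fun _ => e t₀ - d / 3) (g := e) (by linarith) intervalIntegrable_const
      (hint _ _ m2 ht₀') (fun t ht => by
        have := hc₁ (x := t) ⟨by linarith [ht.1, m2.1], ht.2.trans ht₀.2⟩ (by
          rw [Real.dist_eq, abs_lt]; constructor <;> linarith [ht.1, ht.2])
        rw [Real.dist_eq, abs_lt] at this
        linarith [this.1])
    simpa only [intervalIntegral.integral_const, smul_eq_mul, sub_sub_cancel] using this
  have l2 : ∫ t in (0:ℝ)..τ, e t ≤ τ * (e 0 + d / 3) := by
    have := intervalIntegral.integral_mono_on (a := 0) (b := τ) (μ := volume)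
      (f := e) (g := fun _ => e 0 + d / 3) hτ0.le (hint _ _ h0T m1) intervalIntegrable_const
      (fun t ht => by
        have := hc₀ (x := t) ⟨ht.1, ht.2.trans m1.2⟩ (by
          rw [Real.dist_eq, abs_lt]; constructor <;> linarith [ht.1, ht.2])
        rw [Real.dist_eq, abs_lt] at this
        linarith [this.2])
    simpa only [intervalIntegral.integral_const, smul_eq_mul, sub_zero] using this
  have : τ * (d / 3) = τ * (e t₀ - d / 3) - τ * (e 0 + d / 3) := by rw [hd]; ring
  linarith

/-- Energy inequality: a continuous function whose increments are controlled by the pairing of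
two square integrable functionals with dissipative directions is bounded by its initial value. -/
theorem le_initial_of_increment_le {X : Type*} [NormedAddCommGroup X] [NormedSpace ℝ X] {T : ℝ}
    {e : ℝ → ℝ} (he : ContinuousOn e (Icc 0 T)) {g₁ g₂ : ℝ → StrongDual ℝ X} {b₁ b₂ : ℝ → ℝ}
    (hg₁ : MemLp g₁ 2 (timeMeasure T)) (hg₂ : MemLp g₂ 2 (timeMeasure T))
    (hb₁ : MemLp b₁ 2 (timeMeasure T)) (hb₂ : MemLp b₂ 2 (timeMeasure T))
    (h : ∀ᵐ t ∂(timeMeasure T), ∃ ψ₁ ψ₂ : X, ‖ψ₁‖ ≤ b₁ t ∧ ‖ψ₂‖ ≤ b₂ t ∧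
      g₁ t ψ₁ + g₂ t ψ₂ ≤ 0 ∧
      ∀ s ∈ Ioo 0 t, e t - e s ≤ (∫ r in s..t, g₁ r ψ₁) + ∫ r in s..t, g₂ r ψ₂)
    {t₀ : ℝ} (ht₀ : t₀ ∈ Icc 0 T) : e t₀ ≤ e 0 := by
  by_contra! hlt
  have ht₀pos : 0 < t₀ := by
    rcases ht₀.1.eq_or_lt with h' | h'
    · rw [← h'] at hlt; exact absurd hlt (lt_irrefl _)
    · exact h'
  have hd0 : 0 < e t₀ - e 0 := sub_pos.2 hlt
  -- Two oscillations of at most `τ d / 12` each, `d = e t₀ - e 0`, give an upper bound `τ d / 6`,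
  -- which contradicts the lower bound `τ d / 3`.
  have hη : (0:ℝ≥0∞) < ENNReal.ofReal ((e t₀ - e 0) / 12) := ENNReal.ofReal_pos.2 (by positivity)
  have hg₁' : MemLp ((Ioo 0 T).indicator g₁) 2 := hg₁.indicator_Ioo
  have hg₂' : MemLp ((Ioo 0 T).indicator g₂) 2 := hg₂.indicator_Ioo
  have hb₁' : MemLp ((Ioo 0 T).indicator b₁) 2 := hb₁.indicator_Ioo
  have hb₂' : MemLp ((Ioo 0 T).indicator b₂) 2 := hb₂.indicator_Ioo
  have hi₁ : Integrable g₁ (timeMeasure T) := hg₁.integrable one_le_two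
  have hi₂ : Integrable g₂ (timeMeasure T) := hg₂.integrable one_le_two
  obtain ⟨τ, ⟨⟨⟨hτ₁, hτ₂⟩, hτt₀, hi, hlow⟩, hτ0⟩⟩ :=
    ((((eventually_lintegral_oscillation_le hg₁' hb₁' hη).and
      (eventually_lintegral_oscillation_le hg₂' hb₂' hη)).and
      (eventually_le_integral_increment he ⟨ht₀pos, ht₀.2⟩ hlt)).and
      self_mem_nhdsWithin).exists
  replace hτ0 : 0 < τ := hτ0
  have hsub : Ioo τ t₀ ⊆ Ioo 0 T := Ioo_subset_Ioo hτ0.le ht₀.2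
  have hpt : ∀ᵐ t ∂(volume.restrict (Ioo τ t₀)), ENNReal.ofReal (e t - e (t - τ)) ≤
      oscillation ((Ioo 0 T).indicator b₁) ((Ioo 0 T).indicator g₁) τ t +
      oscillation ((Ioo 0 T).indicator b₂) ((Ioo 0 T).indicator g₂) τ t := by
    filter_upwards [ae_restrict_of_ae_restrict_of_subset hsub h,
      ae_restrict_mem measurableSet_Ioo] with t ht htm
    obtain ⟨ψ₁, ψ₂, hψ₁, hψ₂, hdis, hinc⟩ := ht
    rw [← indicator_of_mem (hsub htm) b₁] at hψ₁
    rw [← indicator_of_mem (hsub htm) b₂] at hψ₂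
    refine le_trans ?_ (add_le_add (ofReal_integral_apply_sub_le _ hτ0 hψ₁)
      (ofReal_integral_apply_sub_le _ hτ0 hψ₂))
    refine le_trans (ENNReal.ofReal_le_ofReal ?_) ENNReal.ofReal_add_le
    have := hinc (t - τ) ⟨by linarith [htm.1], by linarith⟩
    rw [integral_apply_eq_integral_sub_add hi₁ hτ0 htm.1 (hsub htm).2,
      integral_apply_eq_integral_sub_add hi₂ hτ0 htm.1 (hsub htm).2]
      at this
    -- The frozen parts `τ * g t ψ` add up to something nonpositive and can be dropped, leaving the
    -- oscillations.
    have h3 := mul_nonneg hτ0.le (sub_nonneg.2 hdis)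
    linarith
  have hup : ∫ t in Ioo τ t₀, (e t - e (t - τ)) ≤ τ * ((e t₀ - e 0) / 6) := by
    refine (integral_le_toReal_lintegral hi).trans ?_
    refine ENNReal.toReal_le_of_le_ofReal (by positivity) ?_
    refine (lintegral_mono_ae hpt).trans ((setLIntegral_le_lintegral _ _).trans ?_)
    rw [lintegral_add_left' (aemeasurable_oscillation hg₁'.aestronglyMeasurable
      hb₁'.aestronglyMeasurable τ)]
    refine (add_le_add hτ₁ hτ₂).trans_eq ?_
    rw [← ENNReal.ofReal_mul (by positivity), ← ENNReal.ofReal_add (by positivity) (by positivity)]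
    congr 1
    ring
  have : 0 < τ * (e t₀ - e 0) := mul_pos hτ0 hd0
  linarith

end Time

end SNPP

/-! ### Truncations, their convex energies and the comparison principle -/

namespace SNPP

section Ramp

/-- The derivative of `ramp L`. -/
def window (L : ℝ) : ℝ → ℝ := (Ioo L (L + 1)).indicator fun _ => 1

/-- The truncated positive part `min (s - L)₊ 1`. -/
def ramp (L s : ℝ) : ℝ := max 0 (min (s - L) 1)

theorem window_nonneg (L s : ℝ) : 0 ≤ window L s :=
  indicator_nonneg (fun _ _ => zero_le_one) s

theorem isBoundedLimit_window (L : ℝ) : IsBoundedLimit (window L) 1 :=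
  isBoundedLimit_indicator continuous_const zero_le_one fun _ _ => by simp

/-- The condition `0 ≤ L` puts the base point `0` of the primitive below the window, which fixes the
constant of integration. -/
theorem primitive_window {L : ℝ} (hL : 0 ≤ L) (s : ℝ) : primitive (window L) s = ramp L s := by
  have hf := isBoundedLimit_window L
  have below : ∀ s ≤ L, primitive (window L) s = 0 := by
    intro s hs
    rw [primitive, intervalIntegral.integral_congr (g := fun _ => 0),
      intervalIntegral.integral_zero]
    intro r hr
    refine indicator_of_notMem (fun h => ?_) _
    have : r ≤ L := hr.2.trans (sup_le hL hs)
    exact absurd h.1 (not_lt.2 this)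
  have mid : ∀ s, L ≤ s → s ≤ L + 1 → primitive (window L) s = s - L := by
    intro s h1 h2
    have e := primitive_sub hf.measurable hf.abs_le L s
    rw [below L le_rfl, sub_zero] at e
    rw [e, intervalIntegral.integral_of_le h1, integral_Ioc_eq_integral_Ioo,
      setIntegral_congr_fun (g := fun _ => (1:ℝ)) measurableSet_Ioo]
    · simp [h1]
    · exact fun r hr => indicator_of_mem (show r ∈ Ioo L (L + 1) from ⟨hr.1, hr.2.trans_le h2⟩) _
  have above : ∀ s, L + 1 ≤ s → primitive (window L) s = 1 := by
    intro s h1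
    have e := primitive_sub hf.measurable hf.abs_le (L + 1) s
    rw [intervalIntegral.integral_congr (g := fun _ => 0), intervalIntegral.integral_zero,
      mid (L + 1) (by linarith) le_rfl] at e
    · linarith
    · intro r hr
      rw [uIcc_of_le h1] at hr
      exact indicator_of_notMem (fun h => absurd h.2 (not_lt.2 hr.1)) _
  rw [ramp]
  rcases le_total s L with h | h
  · rw [below s h, min_eq_left (by linarith), max_eq_left (by linarith)]
  · rcases le_total s (L + 1) with h' | h'
    · rw [mid s h h', min_eq_left (by linarith), max_eq_right (by linarith)]
    · rw [above s h', min_eq_right (by linarith), max_eq_right (by linarith)]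

theorem ramp_nonneg (L s : ℝ) : 0 ≤ ramp L s := le_max_left _ _

theorem abs_ramp_le (L s : ℝ) : |ramp L s| ≤ 1 := by
  rw [abs_of_nonneg (ramp_nonneg L s)]
  exact max_le zero_le_one (min_le_right _ _)

theorem ramp_mono (L : ℝ) : Monotone (ramp L) := fun a b h => by
  unfold ramp; gcongr

theorem continuous_ramp (L : ℝ) : Continuous (ramp L) := by
  unfold ramp; fun_prop

theorem ramp_of_le {L s : ℝ} (h : s ≤ L) : ramp L s = 0 := by
  rw [ramp, min_eq_left (by linarith), max_eq_left (by linarith)]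

theorem ramp_pos {L s : ℝ} (h : L < s) : 0 < ramp L s :=
  lt_max_of_lt_right (lt_min (by linarith) one_pos)

/-- A convex primitive of `ramp L`. -/
def rampEnergy (L : ℝ) : ℝ → ℝ := primitive (ramp L)

/-- Tangent inequality at `b` for a convex function: the derivative `ramp L` is monotone, so on the
interval between `a` and `b` it is compared with its value at `b`. -/
theorem rampEnergy_sub_le (L a b : ℝ) :
    rampEnergy L b - rampEnergy L a ≤ ramp L b * (b - a) := by
  rw [rampEnergy, primitive_sub (continuous_ramp L).measurable (abs_ramp_le L)]
  rcases le_total a b with h | h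
  · have := intervalIntegral.integral_mono_on (μ := volume) h
      ((continuous_ramp L).intervalIntegrable a b) (intervalIntegrable_const (c := ramp L b))
      (fun r hr => ramp_mono L hr.2)
    simpa [mul_comm] using this
  · have := intervalIntegral.integral_mono_on (μ := volume) h
      (intervalIntegrable_const (c := ramp L b)) ((continuous_ramp L).intervalIntegrable b a)
      (fun r hr => ramp_mono L hr.1)
    rw [intervalIntegral.integral_symm]
    rw [intervalIntegral.integral_const, smul_eq_mul] at this
    linarith

theorem rampEnergy_of_le {L s : ℝ} (hL : 0 ≤ L) (h : s ≤ L) : rampEnergy L s = 0 := by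
  have h0 : rampEnergy L 0 = 0 := primitive_zero _
  have h1 := rampEnergy_sub_le L 0 s
  have h2 := rampEnergy_sub_le L s 0
  rw [ramp_of_le h] at h1
  rw [ramp_of_le hL] at h2
  linarith

theorem rampEnergy_nonneg {L : ℝ} (hL : 0 ≤ L) (s : ℝ) : 0 ≤ rampEnergy L s := by
  have h := rampEnergy_sub_le L s L
  rw [ramp_of_le le_rfl, rampEnergy_of_le hL le_rfl] at h
  linarith

theorem rampEnergy_pos {L s : ℝ} (hL : 0 ≤ L) (h : L < s) : 0 < rampEnergy L s := by
  -- The tangent at `L` is horizontal. The one at the midpoint has positive slope and lies strictly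
  -- above zero at `s`.
  have h1 := rampEnergy_sub_le L s ((L + s) / 2)
  have h2 := rampEnergy_nonneg hL ((L + s) / 2)
  have h3 := mul_pos (ramp_pos (show L < (L + s) / 2 by linarith)) (sub_pos.2 h)
  nlinarith

theorem lipschitzWith_rampEnergy (L : ℝ) : LipschitzWith 1 (rampEnergy L) :=
  LipschitzWith.of_dist_le_mul fun a b => by
    simpa [Real.dist_eq, rampEnergy] using
      abs_primitive_sub_le (continuous_ramp L).measurable (abs_ramp_le L) b a

end Ramp

section Comparison

theorem integrable_apply_of_memLp {X : Type*} [NormedAddCommGroup X] [NormedSpace ℝ X] {T : ℝ}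
    {g : ℝ → StrongDual ℝ X} (hg : MemLp g 2 (timeMeasure T)) (φ : X) :
    Integrable (fun r => g r φ) (timeMeasure T) :=
  (hg.integrable one_le_two).apply_continuousLinearMap φ

variable {n : ℕ} {U : Set (E n)} {T : ℝ}

/-- `c ∈ L²(0,T;H¹)` has the weak time derivative `g ∈ L²(0,T;(H¹)')` and the continuous
representative `C`. -/
structure IsEvolution (T : ℝ) (c : ℝ → H1 U) (g : ℝ → StrongDual ℝ (H1 U)) (C : ℝ → L2 U) :
    Prop where
  mem : MemLp c 2 (timeMeasure T)
  deriv_mem : MemLp g 2 (timeMeasure T)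
  weakDeriv : IsWeakTimeDeriv T c g
  continuousOn : ContinuousOn C (Icc 0 T)
  ae_eq : ∀ᵐ t ∂(timeMeasure T), C t = (c t).fn

/-- For a fixed `φ` the pairing is a continuous scalar function with an integrable weak derivative.
This gives the increment for all `s < t` in the open interval, without an exceptional set. -/
theorem IsEvolution.inner_sub {c : ℝ → H1 U} {g : ℝ → StrongDual ℝ (H1 U)} {C : ℝ → L2 U}
    (h : IsEvolution T c g C) (φ : H1 U) {s t : ℝ} (hs : 0 < s) (hst : s < t) (ht : t < T) :
    ⟪C t - C s, φ.fn⟫ = ∫ r in s..t, g r φ := by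
  have hk : Integrable (fun r => g r φ) (timeMeasure T) :=
    integrable_apply_of_memLp h.deriv_mem φ
  rw [inner_sub_left]
  refine sub_eq_integral_of_weakDeriv (f := fun t => ⟪C t, φ.fn⟫)
    (h.continuousOn.inner continuousOn_const) hk (fun η h1 h2 h3 => ?_) hs hst ht
  refine Eq.trans (integral_congr_ae ?_) (h.weakDeriv φ η h1 h2 h3)
  filter_upwards [h.ae_eq] with r hr
  rw [hr]

/-- The integral of `rampEnergy L` over `U`. -/
def energy [IsFiniteMeasure ((volume : Measure (E n)).restrict U)] (L : ℝ) (w : L2 U) : ℝ :=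
  ⟪Lp.const 2 (volume.restrict U) (1:ℝ),
    (lipschitzWith_rampEnergy L).compLp (primitive_zero _) w⟫

variable [IsFiniteMeasure ((volume : Measure (E n)).restrict U)]

/-- Composition with a Lipschitz function is continuous on `L²`, and the energy is its pairing with
the constant one. Hence energies are continuous in time along the continuous representative. -/
theorem continuous_energy (L : ℝ) : Continuous (energy (U := U) L) :=
  continuous_const.inner ((lipschitzWith_rampEnergy L).continuous_compLp (primitive_zero _))

theorem integrable_rampEnergy (L : ℝ) (w : L2 U) :
    Integrable (fun x => rampEnergy L (w x)) (volume.restrict U) :=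
  ((Lp.memLp ((lipschitzWith_rampEnergy L).compLp (primitive_zero _) w)).integrable
    one_le_two).congr ((lipschitzWith_rampEnergy L).coeFn_compLp (primitive_zero _) w)

theorem energy_eq (L : ℝ) (w : L2 U) : energy L w = ∫ x in U, rampEnergy L (w x) := by
  rw [energy, L2.inner_def]
  refine integral_congr_ae ?_
  filter_upwards [(lipschitzWith_rampEnergy L).coeFn_compLp (primitive_zero _) w,
    Lp.coeFn_const 2 (volume.restrict U) (1:ℝ)] with x h1 h2
  rw [h1, h2]
  simp

theorem energy_nonneg {L : ℝ} (hL : 0 ≤ L) (w : L2 U) : 0 ≤ energy L w := by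
  rw [energy_eq]
  exact integral_nonneg fun x => rampEnergy_nonneg hL _

theorem energy_eq_zero_iff {L : ℝ} (hL : 0 ≤ L) (w : L2 U) :
    energy L w = 0 ↔ ∀ᵐ x ∂(volume.restrict U), w x ≤ L := by
  rw [energy_eq, integral_eq_zero_iff_of_nonneg_ae
    (Eventually.of_forall fun x => rampEnergy_nonneg hL _) (integrable_rampEnergy L w)]
  refine eventually_congr (Eventually.of_forall fun x => ⟨fun h => ?_, fun h => ?_⟩)
  · by_contra! hc
    exact (rampEnergy_pos hL hc).ne' h
  · exact rampEnergy_of_le hL h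

/-- The pointwise tangent inequality, integrated. It replaces a chain rule in time, and the
truncation is taken at `w` only. -/
theorem energy_sub_le (L : ℝ) (w w' ψ : L2 U)
    (hψ : ψ =ᵐ[volume.restrict U] fun x => ramp L (w x)) :
    energy L w - energy L w' ≤ ⟪w - w', ψ⟫ := by
  rw [energy_eq, energy_eq, ← integral_sub (integrable_rampEnergy L w) (integrable_rampEnergy L w'),
    L2.inner_def]
  refine integral_mono_ae ((integrable_rampEnergy L w).sub (integrable_rampEnergy L w'))
    (L2.integrable_inner _ _) ?_
  filter_upwards [hψ, Lp.coeFn_sub w w'] with x h1 h2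
  rw [h1, h2]
  exact rampEnergy_sub_le L _ _

/-- `φ = min (c - L)₊ 1` as an element of `H¹(U)`. -/
def IsRamp (L : ℝ) (c φ : H1 U) : Prop :=
  (φ.fn =ᵐ[volume.restrict U] fun x => ramp L (c.fn x)) ∧
    φ.grad =ᵐ[volume.restrict U] fun x => window L (c.fn x) • c.grad x

theorem exists_isRamp (hU : IsOpen U) {L : ℝ} (hL : 0 ≤ L) (c : H1 U) :
    ∃ φ : H1 U, IsRamp L c φ ∧ ‖φ‖ ≤ ‖c‖ := by
  obtain ⟨φ, h1, h2⟩ := c.exists_primitive_comp hU (isFiniteMeasure_restrict.1 inferInstance)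
    (isBoundedLimit_window L)
  refine ⟨φ, ⟨?_, h2⟩, ?_⟩
  · simpa only [primitive_window hL] using h1
  · simpa using H1.norm_le_of_primitive_comp (isBoundedLimit_window L) h1 h2

/-- Comparison principle: if the total energy of the truncations above the level `L` is
dissipated, then this level is never exceeded. -/
theorem boundedAbove_of_dissipative (hU : IsOpen U) {L : ℝ} (hL : 0 ≤ L)
    {c₁ c₂ : ℝ → H1 U} {g₁ g₂ : ℝ → StrongDual ℝ (H1 U)} {C₁ C₂ : ℝ → L2 U}
    (h₁ : IsEvolution T c₁ g₁ C₁) (h₂ : IsEvolution T c₂ g₂ C₂)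
    (h₁0 : ∀ᵐ x ∂(volume.restrict U), C₁ 0 x ≤ L) (h₂0 : ∀ᵐ x ∂(volume.restrict U), C₂ 0 x ≤ L)
    (hdis : ∀ᵐ t ∂(timeMeasure T), ∀ φ₁ φ₂, IsRamp L (c₁ t) φ₁ → IsRamp L (c₂ t) φ₂ →
      g₁ t φ₁ + g₂ t φ₂ ≤ 0) :
    BoundedAboveBy T c₁ L ∧ BoundedAboveBy T c₂ L := by
  have hE : ContinuousOn (fun t => energy L (C₁ t) + energy L (C₂ t)) (Icc 0 T) :=
    ((continuous_energy L).comp_continuousOn h₁.continuousOn).add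
      ((continuous_energy L).comp_continuousOn h₂.continuousOn)
  have hmem : ∀ᵐ t ∂(timeMeasure T), t ∈ Ioo 0 T := ae_restrict_mem measurableSet_Ioo
  have key : ∀ t ∈ Icc 0 T, energy L (C₁ t) + energy L (C₂ t) ≤
      energy L (C₁ 0) + energy L (C₂ 0) := by
    intro t ht
    -- The truncation has slope at most one, so the norms `‖c₁ t‖` and `‖c₂ t‖` serve as the square
    -- integrable bounds on the test functions.
    refine le_initial_of_increment_le hE h₁.deriv_mem h₂.deriv_mem h₁.mem.norm h₂.mem.norm ?_ ht
    filter_upwards [hdis, h₁.ae_eq, h₂.ae_eq, hmem] with r hr e₁ e₂ hrm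
    obtain ⟨φ₁, k₁, n₁⟩ := exists_isRamp hU hL (c₁ r)
    obtain ⟨φ₂, k₂, n₂⟩ := exists_isRamp hU hL (c₂ r)
    refine ⟨φ₁, φ₂, n₁, n₂, hr φ₁ φ₂ k₁ k₂, fun s hs => ?_⟩
    rw [← h₁.inner_sub φ₁ hs.1 hs.2 hrm.2, ← h₂.inner_sub φ₂ hs.1 hs.2 hrm.2]
    have i₁ := energy_sub_le L (C₁ r) (C₁ s) φ₁.fn (by rw [e₁]; exact k₁.1)
    have i₂ := energy_sub_le L (C₂ r) (C₂ s) φ₂.fn (by rw [e₂]; exact k₂.1)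
    linarith
  rw [(energy_eq_zero_iff hL (C₁ 0)).2 h₁0, (energy_eq_zero_iff hL (C₂ 0)).2 h₂0] at key
  have hb : ∀ t ∈ Ioo 0 T, energy L (C₁ t) = 0 ∧ energy L (C₂ t) = 0 := by
    intro t ht
    have := key t (Ioo_subset_Icc_self ht)
    have n₁ := energy_nonneg hL (C₁ t)
    have n₂ := energy_nonneg hL (C₂ t)
    constructor <;> linarith
  constructor
  · filter_upwards [h₁.ae_eq, hmem] with t e ht
    rw [← e]
    exact (energy_eq_zero_iff hL _).1 (hb t ht).1
  · filter_upwards [h₂.ae_eq, hmem] with t e ht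
    rw [← e]
    exact (energy_eq_zero_iff hL _).1 (hb t ht).2

end Comparison

end SNPP

/-! ### Consequences of the volume additivity constraint -/

namespace SNPP

section VolumeAdditivity

theorem integral_deriv_eq_zero_of_compactSupport {η : ℝ → ℝ} (h1 : ContDiff ℝ ∞ η)
    (h2 : HasCompactSupport η) : ∫ t, deriv η t = 0 :=
  integral_eq_zero_of_hasDerivAt_of_integrable
    (fun t => (h1.differentiable (by simp) t).hasDerivAt)
    ((h1.continuous_deriv (by simp)).integrable_of_hasCompactSupport h2.deriv)
    (h1.continuous.integrable_of_hasCompactSupport h2)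

theorem integrable_fun_add {α Y : Type*} [MeasurableSpace α] {μ : Measure α}
    [NormedAddCommGroup Y] {f g : α → Y} (hf : Integrable f μ) (hg : Integrable g μ) :
    Integrable (fun x => f x + g x) μ :=
  hf.add hg

/-- Two functionals whose sum vanishes as a distribution are opposite almost everywhere. -/
theorem ae_apply_add_eq_zero {X : Type*} [NormedAddCommGroup X] [NormedSpace ℝ X] {T : ℝ}
    {g₁ g₂ : ℝ → StrongDual ℝ X} (hg₁ : MemLp g₁ 2 (timeMeasure T))
    (hg₂ : MemLp g₂ 2 (timeMeasure T))
    (h : ∀ (φ : X) (η : ℝ → ℝ), ContDiff ℝ ∞ η → HasCompactSupport η → tsupport η ⊆ Ioo 0 T →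
      ∫ t, η t * g₁ t φ ∂(timeMeasure T) + ∫ t, η t * g₂ t φ ∂(timeMeasure T) = 0) :
    ∀ᵐ t ∂(timeMeasure T), ∀ φ, g₁ t φ + g₂ t φ = 0 := by
  have i₁ : Integrable g₁ (timeMeasure T) := hg₁.integrable one_le_two
  have i₂ : Integrable g₂ (timeMeasure T) := hg₂.integrable one_le_two
  have hi : IntegrableOn (fun t => g₁ t + g₂ t) (Ioo 0 T) := integrable_fun_add i₁ i₂
  -- The fundamental lemma is applied to functions with values in the dual space, so one null set of
  -- times serves all `φ`.
  have key : ∀ᵐ t, t ∈ Ioo 0 T → g₁ t + g₂ t = 0 := by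
    refine isOpen_Ioo.ae_eq_zero_of_integral_contDiff_smul_eq_zero hi.locallyIntegrableOn
      fun η h1 h2 h3 => ?_
    obtain ⟨K, hK⟩ := h1.continuous.bounded_above_of_compact_support h2
    have j : ∀ {g : ℝ → StrongDual ℝ X}, Integrable g (timeMeasure T) →
        Integrable (fun t => η t • g t) (timeMeasure T) := fun hg =>
      hg.bdd_smul K h1.continuous.aestronglyMeasurable (Eventually.of_forall hK)
    rw [← setIntegral_eq_integral_of_forall_compl_eq_zero (s := Ioo 0 T) fun t ht => by
      rw [image_eq_zero_of_notMem_tsupport fun h' => ht (h3 h'), zero_smul]]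
    change ∫ t, η t • (g₁ t + g₂ t) ∂(timeMeasure T) = 0
    simp_rw [smul_add]
    rw [integral_add (j i₁) (j i₂)]
    refine ContinuousLinearMap.ext fun φ => ?_
    rw [_root_.add_apply, ContinuousLinearMap.integral_apply (j i₁),
      ContinuousLinearMap.integral_apply (j i₂)]
    exact h φ η h1 h2 h3
  rw [timeMeasure, ae_restrict_iff' measurableSet_Ioo]
  filter_upwards [key] with t ht hmem φ
  rw [← _root_.add_apply, ht hmem, _root_.zero_apply]

variable {n : ℕ} {U : Set (E n)} {T : ℝ}

theorem IsTestFunction.integral_gradient {φ : E n → ℝ} (hφ : IsTestFunction U φ) :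
    ∫ x in U, gradient φ x = 0 := by
  have h0 : ∀ x, x ∉ U → gradient φ x = 0 := fun x hx => by
    have : fderiv ℝ φ x = 0 := Function.notMem_support.1 fun h' =>
      hx (((support_fderiv_subset ℝ (f := φ)).trans hφ.support) h')
    simp [gradient, this]
  rw [setIntegral_eq_integral_of_forall_compl_eq_zero h0]
  have hi := hφ.continuous_gradient.integrable_of_hasCompactSupport (μ := volume)
    hφ.compact_gradient
  refine ext_inner_left ℝ fun v => ?_
  rw [← integral_inner hi, inner_zero_right]
  have k1 : Integrable (fun x => (1:ℝ) * fderiv ℝ φ x v) := by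
    simp_rw [one_mul]
    exact (hφ.continuous_fderiv_apply v).integrable_of_hasCompactSupport (hφ.compact_fderiv_apply v)
  have k2 : Integrable (fun x => (1:ℝ) * φ x) := by
    simp_rw [one_mul]
    exact hφ.smooth.continuous.integrable_of_hasCompactSupport hφ.compact
  have := integral_mul_fderiv_eq_neg_fderiv_mul_of_integrable (μ := (volume : Measure (E n)))
    (f := fun _ => (1:ℝ)) (g := φ) (v := v) (by simp) k1 k2
    (fun x _ => differentiableAt_const _) (fun x _ => hφ.smooth.differentiable (by simp) x)
  simp only [one_mul, fderiv_fun_const, Pi.zero_apply, _root_.zero_apply, zero_mul, integral_zero,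
    neg_zero] at this
  rw [← this]
  refine integral_congr_ae (Eventually.of_forall fun x => ?_)
  simp only
  rw [real_inner_comm, inner_gradient]

variable [IsFiniteMeasure ((volume : Measure (E n)).restrict U)]

theorem fn_add_fn_eq_const {u w : L2 U}
    (h : ∀ᵐ x ∂(volume.restrict U), u x + w x = 1) :
    u + w = Lp.const 2 (volume.restrict U) (1:ℝ) := by
  refine Lp.ext ?_
  filter_upwards [h, Lp.coeFn_add u w, Lp.coeFn_const 2 (volume.restrict U) (1:ℝ)] with x h1 h2 h3
  rw [h2, h3, Pi.add_apply, h1]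
  rfl

/-- The sum of the concentrations does not depend on time, and the derivative of a compactly
supported `η` integrates to zero. -/
theorem VolumeAdditivity.ae_apply_add_eq_zero {c₁ c₂ : ℝ → H1 U}
    {g₁ g₂ : ℝ → StrongDual ℝ (H1 U)} {C₁ C₂ : ℝ → L2 U} (h : VolumeAdditivity T c₁ c₂)
    (h₁ : IsEvolution T c₁ g₁ C₁) (h₂ : IsEvolution T c₂ g₂ C₂) :
    ∀ᵐ t ∂(timeMeasure T), ∀ φ, g₁ t φ + g₂ t φ = 0 := by
  refine SNPP.ae_apply_add_eq_zero h₁.deriv_mem h₂.deriv_mem fun φ η k1 k2 k3 => ?_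
  obtain ⟨K, hK⟩ := (k1.continuous_deriv (by simp)).bounded_above_of_compact_support
    (k2.deriv)
  have hi : ∀ {c : ℝ → H1 U} {g : ℝ → StrongDual ℝ (H1 U)} {C : ℝ → L2 U}, IsEvolution T c g C →
      Integrable (fun t => deriv η t * ⟪(c t).fn, φ.fn⟫) (timeMeasure T) := by
    intro c g C hc
    have a1 : IntegrableOn (fun t => ⟪C t, φ.fn⟫) (Ioo 0 T) :=
      ((hc.continuousOn.inner continuousOn_const).integrableOn_Icc).mono_set Ioo_subset_Icc_self
    have a2 : Integrable (fun t => ⟪(c t).fn, φ.fn⟫) (timeMeasure T) := by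
      refine Integrable.congr a1 ?_
      filter_upwards [hc.ae_eq] with t ht
      rw [ht]
    exact a2.bdd_mul (k1.continuous_deriv (by simp)).aestronglyMeasurable
      (Eventually.of_forall hK)
  have e1 := h₁.weakDeriv φ η k1 k2 k3
  have e2 := h₂.weakDeriv φ η k1 k2 k3
  have e3 : (∫ t, deriv η t * ⟪(c₁ t).fn, φ.fn⟫ ∂(timeMeasure T))
      + ∫ t, deriv η t * ⟪(c₂ t).fn, φ.fn⟫ ∂(timeMeasure T) = 0 := by
    rw [← integral_add (hi h₁) (hi h₂)]
    have : ∀ᵐ t ∂(timeMeasure T), deriv η t * ⟪(c₁ t).fn, φ.fn⟫ + deriv η t * ⟪(c₂ t).fn, φ.fn⟫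
        = deriv η t * ⟪Lp.const 2 (volume.restrict U) (1:ℝ), φ.fn⟫ := by
      filter_upwards [h] with t ht
      rw [← mul_add, ← inner_add_left, fn_add_fn_eq_const ht]
    rw [integral_congr_ae this, integral_mul_const]
    have : ∫ t, deriv η t ∂(timeMeasure T) = 0 := by
      rw [timeMeasure, setIntegral_eq_integral_of_forall_compl_eq_zero,
        integral_deriv_eq_zero_of_compactSupport k1 k2]
      intro t ht
      exact image_eq_zero_of_notMem_tsupport fun h' => ht (k3 (tsupport_deriv_subset h'))
    rw [this, zero_mul]
  linarith

/-- The constraint holds for almost every positive time and reaches `t = 0` by continuity of the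
representatives. -/
theorem VolumeAdditivity.initial {c₁ c₂ : ℝ → H1 U}
    {g₁ g₂ : ℝ → StrongDual ℝ (H1 U)} {C₁ C₂ : ℝ → L2 U} (hT : 0 < T)
    (h : VolumeAdditivity T c₁ c₂)
    (h₁ : IsEvolution T c₁ g₁ C₁) (h₂ : IsEvolution T c₂ g₂ C₂) :
    ∀ᵐ x ∂(volume.restrict U), C₁ 0 x + C₂ 0 x = 1 := by
  have e : (fun t => C₁ t + C₂ t) =ᵐ[volume.restrict (Icc 0 T)]
      fun _ => Lp.const 2 (volume.restrict U) (1:ℝ) := by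
    rw [← Measure.restrict_congr_set Ioo_ae_eq_Icc]
    filter_upwards [h, h₁.ae_eq, h₂.ae_eq] with t ht e1 e2
    rw [e1, e2, fn_add_fn_eq_const ht]
  have e0 := Measure.eqOn_Icc_of_ae_eq volume hT.ne e (h₁.continuousOn.add h₂.continuousOn)
    continuousOn_const (left_mem_Icc.2 hT.le)
  simp only at e0
  filter_upwards [Lp.coeFn_add (C₁ 0) (C₂ 0),
    Lp.coeFn_const 2 (volume.restrict U) (1:ℝ)] with x k1 k2
  rw [← Pi.add_apply, ← k1, e0, k2]
  rfl

theorem H1.grad_add_grad_eq_zero (hU : IsOpen U) {u w : H1 U}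
    (h : ∀ᵐ x ∂(volume.restrict U), u.fn x + w.fn x = 1) :
    ∀ᵐ x ∂(volume.restrict U), u.grad x + w.grad x = 0 := by
  have hi : ∀ z : H1 U, IntegrableOn z.grad U := fun z =>
    (Lp.memLp z.grad).integrable one_le_two
  rw [ae_restrict_iff' hU.measurableSet]
  refine hU.ae_eq_zero_of_integral_contDiff_smul_eq_zero
    ((hi u).add (hi w)).locallyIntegrableOn fun φ h1 h2 h3 => ?_
  have hφ : IsTestFunction U φ := ⟨h1, h2, h3⟩
  rw [← setIntegral_eq_integral_of_forall_compl_eq_zero (s := U) fun x hx => by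
    rw [image_eq_zero_of_notMem_tsupport fun h' => hx (h3 h'), zero_smul]]
  simp_rw [smul_add]
  rw [integral_add (hφ.integrable_smul_vec _) (hφ.integrable_smul_vec _)]
  have e1 := u.isWeakGradient φ hφ
  have e2 := w.isWeakGradient φ hφ
  have e3 : (∫ x in U, u.fn x • gradient φ x) + ∫ x in U, w.fn x • gradient φ x = 0 := by
    rw [← integral_add (hφ.integrable_smul_gradient _) (hφ.integrable_smul_gradient _),
      ← hφ.integral_gradient]
    refine integral_congr_ae ?_
    filter_upwards [h] with x hx
    rw [← add_smul, hx, one_smul]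
  rw [e1, e2, ← neg_add, neg_eq_zero] at e3
  exact e3

end VolumeAdditivity

/-! ### Dissipation of the truncations in both cases -/

section Dissipation

variable {n : ℕ} {U : Set (E n)} {L z ε γ : ℝ}

/-- The gradient of `χ` is `c` times the gradient of `min (c - L)₊ 1`. -/
def IsMoment (L : ℝ) (c χ : H1 U) : Prop :=
  (χ.fn =ᵐ[volume.restrict U] fun x => primitive ((Ioo L (L + 1)).indicator id) (c.fn x)) ∧
    χ.grad =ᵐ[volume.restrict U] fun x => (c.fn x * window L (c.fn x)) • c.grad x

theorem monotone_primitive {f : ℝ → ℝ} {B : ℝ} (hf : IsBoundedLimit f B) (h0 : ∀ s, 0 ≤ f s) :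
    Monotone (primitive f) := fun a b hab => by
  rw [← sub_nonneg, primitive_sub hf.measurable hf.abs_le]
  exact intervalIntegral.integral_nonneg hab fun s _ => h0 s

theorem max_mul_window (hL : 0 ≤ L) (s : ℝ) : max 0 s * window L s = s * window L s := by
  by_cases hs : s ∈ Ioo L (L + 1)
  · rw [max_eq_right (hL.trans hs.1.le)]
  · simp [window, hs]

/-- The diffusive flux dissipates the truncations; the convective flux does not contribute. -/
theorem apply_le_of_isRamp (hL : 0 ≤ L) {v : H1Vec U} {Φ c φ χ : H1 U} {r R : ℝ}
    (hφ : IsRamp L c φ) (hχ : IsMoment L c χ) (hv : ∫ x in U, ⟪v.fn x, χ.grad x⟫ = 0)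
    (hflux : Integrable (fluxTerm z ε γ v Φ c φ) (volume.restrict U))
    (heq : r + ∫ x in U, fluxTerm z ε γ v Φ c φ x = R) :
    r ≤ R - z * ε ^ γ * ∫ x in U, ⟪Φ.grad x, χ.grad x⟫ := by
  have i1 : Integrable (fun x => ⟪c.grad x, φ.grad x⟫) (volume.restrict U) :=
    L2.integrable_inner _ _
  have i2 : Integrable (fun x => ⟪Φ.grad x, χ.grad x⟫) (volume.restrict U) :=
    L2.integrable_inner _ _
  have n1 : 0 ≤ ∫ x in U, ⟪c.grad x, φ.grad x⟫ := by
    refine integral_nonneg_of_ae ?_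
    filter_upwards [hφ.2] with x hx
    rw [hx, real_inner_smul_right]
    exact mul_nonneg (window_nonneg _ _) real_inner_self_nonneg
  -- Since `c ∇φ = ∇χ`, what remains of the flux after removing diffusion and drift is exactly the
  -- convection term. The flux is thus split without proving integrability of the convection term by
  -- itself.
  have e : ∫ x in U, (⟪c.grad x, φ.grad x⟫ + z * ε ^ γ * ⟪Φ.grad x, χ.grad x⟫
      - fluxTerm z ε γ v Φ c φ x) = ∫ x in U, ⟪v.fn x, χ.grad x⟫ := by
    refine integral_congr_ae ?_
    filter_upwards [hφ.2, hχ.2] with x h1 h2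
    have hm := max_mul_window hL (c.fn x)
    simp only [fluxTerm, h1, h2, real_inner_smul_right, inner_add_left, inner_neg_left,
      real_inner_smul_left]
    linear_combination (-(z * ε ^ γ * ⟪Φ.grad x, c.grad x⟫)) * hm
  have i3 : Integrable (fun x => ⟪c.grad x, φ.grad x⟫ + z * ε ^ γ * ⟪Φ.grad x, χ.grad x⟫)
      (volume.restrict U) := i1.add (i2.const_mul _)
  rw [hv, integral_sub i3 hflux, integral_add i1 (i2.const_mul _), integral_const_mul] at e
  linarith

variable [IsFiniteMeasure ((volume : Measure (E n)).restrict U)]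

theorem isBoundedLimit_indicator_id (hL : 0 ≤ L) :
    IsBoundedLimit ((Ioo L (L + 1)).indicator id) (L + 1) :=
  isBoundedLimit_indicator continuous_id (by linarith) fun s hs => by
    rw [id, abs_of_pos (hL.trans_lt hs.1)]
    exact hs.2.le

theorem exists_isMoment (hU : IsOpen U) (hL : 0 ≤ L) (c : H1 U) : ∃ χ : H1 U, IsMoment L c χ := by
  obtain ⟨χ, h1, h2⟩ := c.exists_primitive_comp hU (isFiniteMeasure_restrict.1 inferInstance)
    (isBoundedLimit_indicator_id hL)
  refine ⟨χ, h1, h2.trans (Eventually.of_forall fun x => ?_)⟩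
  by_cases hx : c.fn x ∈ Ioo L (L + 1) <;> simp [window, hx]

/-- Without volume additivity, the drift terms are dissipative in total if the potential
solves the Poisson equation with homogeneous Neumann conditions. -/
theorem dissipation_of_neumann (hU : IsOpen U) (hL : 0 ≤ L) (hε : 0 < ε) {α : ℝ} {v : H1Vec U}
    {Φ cp cm φ₁ φ₂ : H1 U} {r₁ r₂ : ℝ} (hφ₁ : IsRamp L cp φ₁) (hφ₂ : IsRamp L cm φ₂)
    (hv : ∀ χ : H1 U, ∫ x in U, ⟪v.fn x, χ.grad x⟫ = 0)
    (hΦ : ∀ χ : H1 U, ∫ x in U, ε ^ α * ⟪Φ.grad x, χ.grad x⟫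
      = ∫ x in U, (cp.fn x - cm.fn x) * χ.fn x)
    (h₁ : Integrable (fluxTerm 1 ε γ v Φ cp φ₁) (volume.restrict U) ∧
      r₁ + ∫ x in U, fluxTerm 1 ε γ v Φ cp φ₁ x
        = ∫ x in U, -(1 * (cp.fn x - cm.fn x)) * φ₁.fn x)
    (h₂ : Integrable (fluxTerm (-1) ε γ v Φ cm φ₂) (volume.restrict U) ∧
      r₂ + ∫ x in U, fluxTerm (-1) ε γ v Φ cm φ₂ x
        = ∫ x in U, -(-1 * (cp.fn x - cm.fn x)) * φ₂.fn x) :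
    r₁ + r₂ ≤ 0 := by
  obtain ⟨χ₁, hχ₁⟩ := exists_isMoment hU hL cp
  obtain ⟨χ₂, hχ₂⟩ := exists_isMoment hU hL cm
  have b₁ := apply_le_of_isRamp hL hφ₁ hχ₁ (hv χ₁) h₁.1 h₁.2
  have b₂ := apply_le_of_isRamp hL hφ₂ hχ₂ (hv χ₂) h₂.1 h₂.2
  have hi : ∀ u : H1 U, Integrable (fun x => (cp.fn x - cm.fn x) * u.fn x)
      (volume.restrict U) := fun u =>
    ((Lp.memLp cp.fn).sub (Lp.memLp cm.fn)).integrable_mul (Lp.memLp u.fn)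
  have hpair : ∀ (u₁ u₂ : H1 U), (∀ᵐ x ∂(volume.restrict U),
      0 ≤ (cp.fn x - cm.fn x) * (u₁.fn x - u₂.fn x)) →
      ∫ x in U, (cp.fn x - cm.fn x) * u₂.fn x ≤ ∫ x in U, (cp.fn x - cm.fn x) * u₁.fn x := by
    intro u₁ u₂ h
    refine integral_mono_ae (hi u₂) (hi u₁) ?_
    filter_upwards [h] with x hx
    linarith
  have hmono : ∀ {F : ℝ → ℝ}, Monotone F → ∀ a b, 0 ≤ (a - b) * (F a - F b) := by
    intro F hF a b
    rcases le_total a b with h | h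
    · exact mul_nonneg_of_nonpos_of_nonpos (sub_nonpos.2 h) (sub_nonpos.2 (hF h))
    · exact mul_nonneg (sub_nonneg.2 h) (sub_nonneg.2 (hF h))
  have p1 := hpair φ₁ φ₂ (by
    filter_upwards [hφ₁.1, hφ₂.1] with x k1 k2
    rw [k1, k2]
    exact hmono (ramp_mono L) _ _)
  have p2 := hpair χ₁ χ₂ (by
    filter_upwards [hχ₁.1, hχ₂.1] with x k1 k2
    rw [k1, k2]
    refine hmono (monotone_primitive (isBoundedLimit_indicator_id hL) fun s => ?_) _ _
    exact indicator_nonneg (fun r hr => hL.trans hr.1.le) s)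
  -- The Poisson equation turns the monotonicity pairing into an ordering of the two drift
  -- integrals. The positive factor `ε ^ α` cancels.
  rw [← hΦ χ₁, ← hΦ χ₂, integral_const_mul, integral_const_mul,
    mul_le_mul_iff_right₀ (Real.rpow_pos_of_pos hε α)] at p2
  have p3 := mul_le_mul_of_nonneg_left p2 (Real.rpow_pos_of_pos hε γ).le
  have e1 : ∫ x in U, -(1 * (cp.fn x - cm.fn x)) * φ₁.fn x
      = - ∫ x in U, (cp.fn x - cm.fn x) * φ₁.fn x := by
    rw [← integral_neg]; congr 1; ext x; ring
  have e2 : ∫ x in U, -(-1 * (cp.fn x - cm.fn x)) * φ₂.fn x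
      = ∫ x in U, (cp.fn x - cm.fn x) * φ₂.fn x := by
    congr 1; ext x; ring
  rw [e1] at b₁
  rw [e2] at b₂
  linarith

/-- The weight relating the drift of one species to the total drift of both. -/
def driftWeight (L : ℝ) : ℝ → ℝ :=
  (Ioo L (L + 1)).indicator fun s => s / max (min s (2 * s - 1)) (min L (2 * L - 1))

/-- The lower cut-off in the denominator is inactive on the window, where `s > L`. It only keeps the
quotient continuous on the whole line. -/
theorem isBoundedLimit_driftWeight (hL : 1 / 2 < L) :
    IsBoundedLimit (driftWeight L) ((L + 1) / min L (2 * L - 1)) := by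
  have hm : 0 < min L (2 * L - 1) := lt_min (by linarith) (by linarith)
  refine isBoundedLimit_indicator ?_ (div_nonneg (by linarith) hm.le) fun s hs => ?_
  · exact continuous_id.div (by fun_prop) fun s => (lt_max_of_lt_right hm).ne'
  · have : 0 < s := by linarith [hs.1]
    rw [abs_of_nonneg (div_nonneg this.le (hm.le.trans (le_max_right _ _)))]
    exact div_le_div₀ (by linarith) hs.2.le hm (le_max_right _ _)

/-- For `s > 1 / 2` the difference of the cut-off concentrations is `min s (2 * s - 1)`, with the
two branches meeting at `s = 1`. It is positive and is the denominator of the weight. -/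
theorem max_sub_max_mul_driftWeight (hL : 1 / 2 < L) (s : ℝ) :
    (max 0 s - max 0 (1 - s)) * driftWeight L s = s * window L s := by
  by_cases hs : s ∈ Ioo L (L + 1)
  · have h1 := hs.1
    have hm : 0 < min s (2 * s - 1) := lt_min (by linarith) (by linarith)
    have hq : max 0 s - max 0 (1 - s) = min s (2 * s - 1) := by
      rw [max_eq_right (by linarith : (0:ℝ) ≤ s)]
      rcases le_total s 1 with h | h
      · rw [max_eq_right (by linarith), min_eq_right (by linarith)]; ring
      · rw [max_eq_left (by linarith), min_eq_left (by linarith)]; ring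
    have hle : min L (2 * L - 1) ≤ min s (2 * s - 1) := by gcongr
    rw [driftWeight, window, indicator_of_mem hs, indicator_of_mem hs, max_eq_left hle, hq]
    field_simp
  · simp [driftWeight, window, hs]

/-- Under volume additivity the total drift vanishes, hence so does the drift of each species
against functions of its own concentration. -/
theorem integral_inner_moment_eq_zero (hU : IsOpen U) (hL : 1 / 2 < L) (hε : 0 < ε)
    {v : H1Vec U} {Φ cp cm c χ : H1 U} {κ : ℝ} (hκ : κ ≠ 0)
    (hsum : ∀ᵐ x ∂(volume.restrict U), cp.fn x + cm.fn x = 1)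
    (hc : ∀ᵐ x ∂(volume.restrict U), max 0 (cp.fn x) - max 0 (cm.fn x)
      = κ * (max 0 (c.fn x) - max 0 (1 - c.fn x)))
    (hχ : IsMoment L c χ) (hv : ∀ χ : H1 U, ∫ x in U, ⟪v.fn x, χ.grad x⟫ = 0)
    (hflux : ∀ θ : H1 U, Integrable (fluxTerm 1 ε γ v Φ cp θ) (volume.restrict U) ∧
      Integrable (fluxTerm (-1) ε γ v Φ cm θ) (volume.restrict U) ∧
      (∫ x in U, fluxTerm 1 ε γ v Φ cp θ x) + ∫ x in U, fluxTerm (-1) ε γ v Φ cm θ x = 0) :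
    ∫ x in U, ⟪Φ.grad x, χ.grad x⟫ = 0 := by
  obtain ⟨θ, -, hθ⟩ := c.exists_primitive_comp hU (isFiniteMeasure_restrict.1 inferInstance)
    (isBoundedLimit_driftWeight hL)
  obtain ⟨f1, f2, f3⟩ := hflux θ
  have i2 : Integrable (fun x => ⟪Φ.grad x, χ.grad x⟫) (volume.restrict U) :=
    L2.integrable_inner _ _
  -- In the summed flux against `∇θ`, opposite gradients cancel diffusion and `c⁺ + c⁻ = 1` reduces
  -- convection to `-v · ∇θ`. The weight turns the drift into that against `∇χ`, with the sign `κ`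
  -- telling which species `c` is.
  have e : ∫ x in U, (ε ^ γ * κ * ⟪Φ.grad x, χ.grad x⟫
      - (fluxTerm 1 ε γ v Φ cp θ x + fluxTerm (-1) ε γ v Φ cm θ x))
      = ∫ x in U, ⟪v.fn x, θ.grad x⟫ := by
    refine integral_congr_ae ?_
    filter_upwards [hθ, hχ.2, hsum, hc, H1.grad_add_grad_eq_zero hU hsum] with x h1 h2 h3 h4 h5
    have hm := max_sub_max_mul_driftWeight hL (c.fn x)
    have h6 : cm.grad x = - cp.grad x := (neg_eq_of_add_eq_zero_right h5).symm
    simp only [fluxTerm, h1, h2, h6, real_inner_smul_right, inner_add_left, inner_neg_left,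
      real_inner_smul_left]
    linear_combination (-(ε ^ γ * κ * ⟪Φ.grad x, c.grad x⟫)) * hm
      + (driftWeight L (c.fn x) * ⟪v.fn x, c.grad x⟫) * h3
      - (ε ^ γ * driftWeight L (c.fn x) * ⟪Φ.grad x, c.grad x⟫) * h4
  have f4 : Integrable (fun x => fluxTerm 1 ε γ v Φ cp θ x + fluxTerm (-1) ε γ v Φ cm θ x)
      (volume.restrict U) := f1.add f2
  rw [hv θ, integral_sub (i2.const_mul _) f4, integral_add f1 f2, f3,
    integral_const_mul, sub_zero] at e
  exact (mul_eq_zero.1 e).resolve_left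
    (mul_ne_zero (Real.rpow_pos_of_pos hε γ).ne' hκ)

/-- Under volume additivity each species dissipates its truncations above a level larger than
one half. -/
theorem dissipation_of_volumeAdditivity (hU : IsOpen U) (hL : 1 / 2 < L) (hε : 0 < ε)
    {v : H1Vec U} {Φ cp cm φ₁ φ₂ : H1 U} {g₁ g₂ : H1 U → ℝ}
    (hφ₁ : IsRamp L cp φ₁) (hφ₂ : IsRamp L cm φ₂)
    (hg : ∀ θ, g₁ θ + g₂ θ = 0)
    (hsum : ∀ᵐ x ∂(volume.restrict U), cp.fn x + cm.fn x = 1)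
    (hv : ∀ χ : H1 U, ∫ x in U, ⟪v.fn x, χ.grad x⟫ = 0)
    (h₁ : ∀ θ, Integrable (fluxTerm 1 ε γ v Φ cp θ) (volume.restrict U) ∧
      g₁ θ + ∫ x in U, fluxTerm 1 ε γ v Φ cp θ x
        = ∫ x in U, -(1 * (cp.fn x - cm.fn x)) * θ.fn x)
    (h₂ : ∀ θ, Integrable (fluxTerm (-1) ε γ v Φ cm θ) (volume.restrict U) ∧
      g₂ θ + ∫ x in U, fluxTerm (-1) ε γ v Φ cm θ x
        = ∫ x in U, -(-1 * (cp.fn x - cm.fn x)) * θ.fn x) :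
    g₁ φ₁ + g₂ φ₂ ≤ 0 := by
  have hL0 : 0 ≤ L := by linarith
  obtain ⟨χ₁, hχ₁⟩ := exists_isMoment hU hL0 cp
  obtain ⟨χ₂, hχ₂⟩ := exists_isMoment hU hL0 cm
  have b₁ := apply_le_of_isRamp hL0 hφ₁ hχ₁ (hv χ₁) (h₁ φ₁).1 (h₁ φ₁).2
  have b₂ := apply_le_of_isRamp hL0 hφ₂ hχ₂ (hv χ₂) (h₂ φ₂).1 (h₂ φ₂).2
  have hflux : ∀ θ : H1 U, Integrable (fluxTerm 1 ε γ v Φ cp θ) (volume.restrict U) ∧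
      Integrable (fluxTerm (-1) ε γ v Φ cm θ) (volume.restrict U) ∧
      (∫ x in U, fluxTerm 1 ε γ v Φ cp θ x) + ∫ x in U, fluxTerm (-1) ε γ v Φ cm θ x = 0 := by
    intro θ
    refine ⟨(h₁ θ).1, (h₂ θ).1, ?_⟩
    have e : ∫ x in U, -(-1 * (cp.fn x - cm.fn x)) * θ.fn x
        = - ∫ x in U, -(1 * (cp.fn x - cm.fn x)) * θ.fn x := by
      rw [← integral_neg]; congr 1; ext x; ring
    linarith [(h₁ θ).2, (h₂ θ).2, hg θ]
  rw [integral_inner_moment_eq_zero hU hL hε one_ne_zero hsum (by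
    filter_upwards [hsum] with x hx
    rw [show cm.fn x = 1 - cp.fn x by linarith, one_mul]) hχ₁ hv hflux, mul_zero, sub_zero] at b₁
  rw [integral_inner_moment_eq_zero hU hL hε (neg_ne_zero.2 one_ne_zero) hsum (by
    filter_upwards [hsum] with x hx
    rw [show cp.fn x = 1 - cm.fn x by linarith]; ring) hχ₂ hv hflux, mul_zero, sub_zero] at b₂
  -- Under the constraint the charge `c⁺ - c⁻` is `2 c⁺ - 1 = -(2 c⁻ - 1)`, so both reaction terms
  -- are `-(2c - 1)` times the truncation.
  have hsgn : ∀ s, 0 ≤ (2 * s - 1) * ramp L s := by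
    intro s
    rcases le_total s L with h | h
    · rw [ramp_of_le h, mul_zero]
    · exact mul_nonneg (by linarith) (ramp_nonneg L s)
  have r₁ : ∫ x in U, -(1 * (cp.fn x - cm.fn x)) * φ₁.fn x ≤ 0 := by
    refine integral_nonpos_of_ae ?_
    filter_upwards [hφ₁.1, hsum] with x k1 k2
    rw [k1, show cm.fn x = 1 - cp.fn x by linarith, Pi.zero_apply]
    linarith [hsgn (cp.fn x)]
  have r₂ : ∫ x in U, -(-1 * (cp.fn x - cm.fn x)) * φ₂.fn x ≤ 0 := by
    refine integral_nonpos_of_ae ?_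
    filter_upwards [hφ₂.1, hsum] with x k1 k2
    rw [k1, show cp.fn x = 1 - cm.fn x by linarith, Pi.zero_apply]
    linarith [hsgn (cm.fn x)]
  linarith

end Dissipation

end SNPP

/-! ### The upper bounds for weak solutions -/

namespace SNPP

section Bounds

variable {n : ℕ} {U Γ ΓD : Set (E n)} {ε α β γ σ ΦD T Λ : ℝ} {c₀p c₀m c₀ : E n → ℝ}
  {v : ℝ → H1Vec U} {p : ℝ → L2 U} {Φ cp cm c : ℝ → H1 U}

theorem SolvesNernstPlanck.exists_isEvolution {z : ℝ}
    (h : SolvesNernstPlanck U z ε γ T c₀ v Φ cp cm c) :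
    ∃ (g : ℝ → StrongDual ℝ (H1 U)) (C : ℝ → L2 U), IsEvolution T c g C ∧
      (∀ᵐ x ∂(volume.restrict U), C 0 x = c₀ x) ∧ ∀ᵐ t ∂(timeMeasure T), ∀ φ : H1 U,
        Integrable (fluxTerm z ε γ (v t) (Φ t) (c t) φ) (volume.restrict U) ∧
        g t φ + (∫ x in U, fluxTerm z ε γ (v t) (Φ t) (c t) φ x)
          = ∫ x in U, -(z * ((cp t).fn x - (cm t).fn x)) * φ.fn x := by
  obtain ⟨g, hg, hd, heq⟩ := h.equation
  obtain ⟨C, hC, hCc, hC0⟩ := h.initial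
  exact ⟨g, C, ⟨h.mem_L2_H1, hg, hd, hC, hCc⟩, hC0, heq⟩

/-- Needed for the borderline case `Λ = 1 / 2`, since dissipation under volume additivity requires a
level strictly above one half. -/
theorem BoundedAboveBy.of_forall_gt (h : ∀ L, Λ < L → BoundedAboveBy T c L) :
    BoundedAboveBy T c Λ := by
  have h' : ∀ k : ℕ, BoundedAboveBy T c (Λ + 1 / ((k:ℝ) + 1)) := fun k =>
    h _ (lt_add_of_pos_right Λ (by positivity))
  filter_upwards [ae_all_iff.2 h'] with t ht
  filter_upwards [ae_all_iff.2 ht] with x hx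
  refine ge_of_tendsto' (x := atTop) (f := fun k : ℕ => Λ + 1 / ((k:ℝ) + 1)) ?_ hx
  simpa using (tendsto_one_div_add_atTop_nhds_zero_nat (𝕜 := ℝ)).const_add Λ

variable [IsFiniteMeasure ((volume : Measure (E n)).restrict U)]

/-- The upper bounds under the volume additivity constraint. -/
theorem IsWeakSolution.boundedAbove_of_volumeAdditivity (hU : IsOpen U) (hne : U.Nonempty)
    (hε : 0 < ε) (hT : 0 < T) (hc₀p : ∀ x ∈ U, 0 ≤ c₀p x ∧ c₀p x ≤ Λ)
    (hc₀m : ∀ x ∈ U, 0 ≤ c₀m x ∧ c₀m x ≤ Λ)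
    (h : IsWeakSolution U Γ ΓD ε α β γ σ ΦD T c₀p c₀m v p Φ cp cm)
    (hadd : VolumeAdditivity T cp cm) :
    (BoundedAboveBy T cp Λ ∧ BoundedAboveBy T cm Λ) ∧
      (BoundedAboveBy T cp 1 ∧ BoundedAboveBy T cm 1) := by
  obtain ⟨g₁, C₁, e₁, i₁, q₁⟩ := h.nernst_planck_pos.exists_isEvolution
  obtain ⟨g₂, C₂, e₂, i₂, q₂⟩ := h.nernst_planck_neg.exists_isEvolution
  have hmem : ∀ᵐ x ∂(volume.restrict U), x ∈ U := ae_restrict_mem hU.measurableSet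
  have h0 : ∀ᵐ x ∂(volume.restrict U), C₁ 0 x + C₂ 0 x = 1 ∧
      (0 ≤ C₁ 0 x ∧ C₁ 0 x ≤ Λ) ∧ (0 ≤ C₂ 0 x ∧ C₂ 0 x ≤ Λ) := by
    filter_upwards [hadd.initial hT e₁ e₂, i₁, i₂, hmem] with x k1 k2 k3 hx
    refine ⟨k1, ?_, ?_⟩
    · rw [k2]; exact hc₀p x hx
    · rw [k3]; exact hc₀m x hx
  have key : ∀ L, 1 / 2 < L → (∀ᵐ x ∂(volume.restrict U), C₁ 0 x ≤ L) →
      (∀ᵐ x ∂(volume.restrict U), C₂ 0 x ≤ L) → BoundedAboveBy T cp L ∧ BoundedAboveBy T cm L := by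
    intro L hL k1 k2
    refine boundedAbove_of_dissipative hU (by linarith) e₁ e₂ k1 k2 ?_
    filter_upwards [hadd, hadd.ae_apply_add_eq_zero e₁ e₂, h.stokes.incompressible, q₁, q₂]
      with t hsum hg hv r₁ r₂ φ₁ φ₂ hφ₁ hφ₂
    exact dissipation_of_volumeAdditivity hU hL hε hφ₁ hφ₂ hg hsum hv r₁ r₂
  -- A nonempty open set has positive measure, so there is a point where the initial values add up
  -- to one and neither exceeds `Λ`.
  have hΛ : 1 / 2 ≤ Λ := by
    have : (ae (volume.restrict U)).NeBot := by
      rw [ae_neBot, Ne, Measure.restrict_eq_zero]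
      exact hU.measure_ne_zero volume hne
    obtain ⟨x, k1, k2, k3⟩ := h0.exists
    linarith
  refine ⟨?_, key 1 (by norm_num) ?_ ?_⟩
  · have hb : ∀ L, Λ < L → BoundedAboveBy T cp L ∧ BoundedAboveBy T cm L := fun L hL =>
      key L (by linarith) (h0.mono fun x hx => hx.2.1.2.trans hL.le)
        (h0.mono fun x hx => hx.2.2.2.trans hL.le)
    exact ⟨.of_forall_gt fun L hL => (hb L hL).1, .of_forall_gt fun L hL => (hb L hL).2⟩
  · exact h0.mono fun x hx => by linarith [hx.2.2.1]
  · exact h0.mono fun x hx => by linarith [hx.2.1.1]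

/-- The upper bounds for homogeneous Neumann conditions of the potential. -/
theorem IsWeakSolution.boundedAbove_of_neumann (hU : IsOpen U) (hne : U.Nonempty)
    (hε : 0 < ε) (hc₀p : ∀ x ∈ U, 0 ≤ c₀p x ∧ c₀p x ≤ Λ)
    (hc₀m : ∀ x ∈ U, 0 ≤ c₀m x ∧ c₀m x ≤ Λ)
    (h : IsWeakSolution U Γ ∅ ε α β γ 0 ΦD T c₀p c₀m v p Φ cp cm) :
    BoundedAboveBy T cp Λ ∧ BoundedAboveBy T cm Λ := by
  obtain ⟨g₁, C₁, e₁, i₁, q₁⟩ := h.nernst_planck_pos.exists_isEvolution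
  obtain ⟨g₂, C₂, e₂, i₂, q₂⟩ := h.nernst_planck_neg.exists_isEvolution
  have hmem : ∀ᵐ x ∂(volume.restrict U), x ∈ U := ae_restrict_mem hU.measurableSet
  have hΛ : 0 ≤ Λ := by
    obtain ⟨x, hx⟩ := hne
    exact (hc₀p x hx).1.trans (hc₀p x hx).2
  refine boundedAbove_of_dissipative hU hΛ e₁ e₂ ?_ ?_ ?_
  · filter_upwards [i₁, hmem] with x k hx
    rw [k]; exact (hc₀p x hx).2
  · filter_upwards [i₂, hmem] with x k hx
    rw [k]; exact (hc₀m x hx).2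
  · filter_upwards [h.poisson.equation, h.stokes.incompressible, q₁, q₂]
      with t hP hv r₁ r₂ φ₁ φ₂ hφ₁ hφ₂
    refine dissipation_of_neumann (α := α) hU hΛ hε hφ₁ hφ₂ hv (fun χ => ?_) (r₁ φ₁) (r₂ φ₂)
    -- With an empty Dirichlet part the trace condition on `χ` is vacuous, and `σ = 0` removes the
    -- surface integral.
    simpa using hP χ (by simp)

end Bounds

theorem isOpen_poreSpace {n : ℕ} {Ω Yl : Set (E n)} {ε : ℝ} (hΩ : IsOpen Ω) :
    IsOpen (poreSpace Ω Yl ε) :=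
  hΩ.inter isOpen_interior

theorem poreSpace_subset {n : ℕ} (Ω Yl : Set (E n)) (ε : ℝ) : poreSpace Ω Yl ε ⊆ Ω :=
  inter_subset_left

end SNPP

end

theorem mainTheorem12 {n : ℕ} (hn1 : 1 ≤ n) (hn3 : n ≤ 3)
    (Ω Yl Ys : Set (SNPP.E n)) (hΩ : IsOpen Ω) (hΩb : Bornology.IsBounded Ω)
    (hΩc : IsConnected Ω) (hY : SNPP.IsCellDecomposition Yl Ys)
    (α β γ σ ΦD T Λ : ℝ) (hT : 0 < T)
    (c₀p c₀m : SNPP.E n → ℝ)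
    (hc₀p_meas : AEStronglyMeasurable c₀p (volume.restrict Ω))
    (hc₀m_meas : AEStronglyMeasurable c₀m (volume.restrict Ω))
    (hc₀p : ∀ x ∈ Ω, 0 ≤ c₀p x ∧ c₀p x ≤ Λ)
    (hc₀m : ∀ x ∈ Ω, 0 ≤ c₀m x ∧ c₀m x ≤ Λ) :
    ∀ ε : ℝ, 0 < ε → ε < 1 → SNPP.IsCoveredByCells Ω ε →
      IsConnected (SNPP.poreSpace Ω Yl ε) →
      SNPP.HasLipschitzBoundary (SNPP.poreSpace Ω Yl ε) →
      ∀ ΓD : Set (SNPP.E n), MeasurableSet ΓD → ΓD ⊆ SNPP.innerBoundary Ω Yl Ys ε →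
      ∀ (v : ℝ → SNPP.H1Vec (SNPP.poreSpace Ω Yl ε)) (p : ℝ → SNPP.L2 (SNPP.poreSpace Ω Yl ε))
        (Φ cp cm : ℝ → SNPP.H1 (SNPP.poreSpace Ω Yl ε)),
      SNPP.IsWeakSolution (SNPP.poreSpace Ω Yl ε) (SNPP.innerBoundary Ω Yl Ys ε) ΓD
        ε α β γ σ ΦD T c₀p c₀m v p Φ cp cm →
      (SNPP.VolumeAdditivity T cp cm →
        (SNPP.BoundedAboveBy T cp Λ ∧ SNPP.BoundedAboveBy T cm Λ) ∧
        (SNPP.BoundedAboveBy T cp 1 ∧ SNPP.BoundedAboveBy T cm 1)) ∧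
      (ΓD = ∅ → σ = 0 →
        SNPP.BoundedAboveBy T cp Λ ∧ SNPP.BoundedAboveBy T cm Λ) := by
  intro ε hε _ _ hconn _ ΓD _ _ v p Φ cp cm h
  have hU := SNPP.isOpen_poreSpace (Yl := Yl) (ε := ε) hΩ
  have hsub := SNPP.poreSpace_subset Ω Yl ε
  have : IsFiniteMeasure ((volume : Measure (SNPP.E n)).restrict (SNPP.poreSpace Ω Yl ε)) :=
    isFiniteMeasure_restrict.2 (hΩb.subset hsub).measure_lt_top.ne
  have hp := fun x hx => hc₀p x (hsub hx)
  have hm := fun x hx => hc₀m x (hsub hx)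
  refine ⟨h.boundedAbove_of_volumeAdditivity hU hconn.nonempty hε hT hp hm, fun hD hσ => ?_⟩
  subst hD hσ
  exact h.boundedAbove_of_neumann hU hconn.nonempty hε hp hm
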